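/- Let $C$ be an ordered field. A $2$-ordered $C$-vector space is a $C$-vector space $G$ with two total orderings $<_0,<_1$, each making $G$ an ordered $C$-vector space. Put $G_\infty=G\cup\{\infty\}$ with $\infty\notin G$ and $G<_i\infty$, and $G_{\pm\infty}=G_\infty\cup\{-\infty\}$ with $-\infty<_iG_\infty$ ($i=0,1$). A Hamel space over $C$ is a $2$-ordered $C$-vector space $G$ together with a map $v:G\to G_\infty$ such that for all $x,y\in G$ and $\lambda\in C\setminus\{0\}$: $v(x)=\infty$ iff $x=0$; $v(x+y)\ge_0\min_0(v(x),v(y))$; $v(\lambda x)=v(x)$; if $0<_1x<_1y$, then $v(x)\ge_0v(y)$; $v(v(x))=v(x)$, where $v(\infty)=\infty$; and $v(x)>_10$. It is independent if for every set $J\subseteq\{0,1\}$ and all $a_i,b_i\in G_{\pm\infty}$ with $a_i<_ib_i$ $(i\in J)$ there is $z\in G$ with $a_i<_iz<_ib_i$ for all $i\in J$; it is dense if for all $a<_0b$ in $G$ there is $c\in G$ with $a<_0v(c)<_0b$. View a Hamel space as a structure with underlying set $G_\infty$ in the language $\mathcal L_{\mathrm{Ham}}=\{0,+,(\lambda_c)_{c\in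 C},<_0,<_1,v,\infty\}$, where $\lambda_c$ is scalar multiplication by $c$ and $g+\infty=\infty+g=\infty+\infty=\lambda_c(\infty)=v(\infty)=\infty$ for all $g\in G$, $c\in C$. Let $T_{\mathrm{Ham}}$ be the $\mathcal L_{\mathrm{Ham}}$-theory whose models are, up to isomorphism, the independent and dense Hamel spaces over $C$. Theorem. $T_{\mathrm{Ham}}$ admits quantifier elimination and is complete: every $\mathcal L_{\mathrm{Ham}}$-formula $\varphi(x_1,\dots,x_n)$, $n\ge 0$, is equivalent modulo $T_{\mathrm{Ham}}$ to a quantifier-free $\mathcal L_{\mathrm{Ham}}$-formula $\psi(x_1,\dots,x_n)$; and $T_{\mathrm{Ham}}$ has a model and, for every $\mathcal L_{\mathrm{Ham}}$-sentence $\sigma$, proves $\sigma$ or $\neg\sigma$. -/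

import Mathlib

universe u w

namespace Hamel

open FirstOrder

/-! ### Extended orders -/

/-- The relation `r` on `S` extended to `S ∪ {∞}` by declaring `S < ∞`. -/
def topLT {S : Type w} (r : S → S → Prop) (a b : WithTop S) : Prop :=
  letI : LT S := ⟨r⟩
  a < b

/-- The reflexive version `≤` of the extended relation on `S ∪ {∞}`. -/
def topLE {S : Type w} (r : S → S → Prop) (a b : WithTop S) : Prop :=
  topLT r a b ∨ a = b

/-- The relation `r` on `S` extended to `S ∪ {-∞, ∞}` by declaring `-∞ < S < ∞`. -/
def botTopLT {S : Type w} (r : S → S → Prop) (a b : WithBot (WithTop S)) : Prop :=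
  letI : LT S := ⟨r⟩
  a < b

/-- The interval `(a, b) = {s ∈ S : a < s < b}`, for `a, b ∈ S ∪ {-∞, ∞}`. -/
def interval {S : Type w} (r : S → S → Prop) (a b : WithBot (WithTop S)) : Set S :=
  {s | botTopLT r a ((s : WithTop S) : WithBot (WithTop S)) ∧
    botTopLT r ((s : WithTop S) : WithBot (WithTop S)) b}

/-- A map `v : S → S ∪ {∞}` extended to `S ∪ {∞}` by `v ∞ = ∞`. -/
def topVal {S : Type w} (v : S → WithTop S) : WithTop S → WithTop S :=
  WithTop.recTopCoe ⊤ v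

/-! ### Hamel spaces -/

/-- An `I`-ordering on the `C`-vector space `G` turning it into an `I`-ordered `C`-vector space:
a family of strict total orderings, each of which is translation invariant and compatible with
multiplication by positive scalars. -/
structure MultiOrder (I C G : Type*) [Field C] [LinearOrder C] [AddCommGroup G] [Module C G] where
  /-- The orderings. -/
  lt : I → G → G → Prop
  strictTotal : ∀ i, IsStrictTotalOrder G (lt i)
  add_lt_add : ∀ i x y z, lt i x y → lt i (x + z) (y + z)
  smul_pos : ∀ i (c : C) x, 0 < c → lt i 0 x → lt i 0 (c • x)

/-- The orderings are independent: for finitely many distinct indices, nonempty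
"order-theoretic" intervals with endpoints in `G ∪ {-∞, ∞}` have a common point. -/
def MultiOrder.IsIndependent {I C G : Type*} [Field C] [LinearOrder C] [AddCommGroup G]
    [Module C G] (O : MultiOrder I C G) : Prop :=
  ∀ (J : Finset I) (a b : I → WithBot (WithTop G)), (∀ i ∈ J, botTopLT (O.lt i) (a i) (b i)) →
    (⋂ i ∈ J, interval (O.lt i) (a i) (b i)).Nonempty

/-- A Hamel space over `C` with underlying vector space `G`: two orderings `lt 0`, `lt 1`, and a
Hamel valuation `v : G → G ∪ {∞}`. -/
structure HamelSpace (C G : Type*) [Field C] [LinearOrder C] [AddCommGroup G] [Module C G] extends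
    MultiOrder (Fin 2) C G where
  /-- The valuation. -/
  v : G → WithTop G
  v_eq_top : ∀ x, v x = ⊤ ↔ x = 0
  /-- `v (x + y) ≥ min (v x) (v y)` with respect to the ordering `<₀`. -/
  v_add : ∀ x y, topLE (lt 0) (v x) (v (x + y)) ∨ topLE (lt 0) (v y) (v (x + y))
  v_smul : ∀ (c : C) x, c ≠ 0 → v (c • x) = v x
  v_convex : ∀ x y, lt 1 0 x → lt 1 x y → topLE (lt 0) (v y) (v x)
  /-- `v (v x) = v x`, where `v ∞ = ∞`. -/
  v_idem : ∀ x, topVal v (v x) = v x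
  v_pos : ∀ x, topLT (lt 1) ((0 : G) : WithTop G) (v x)

/-- A Hamel space is independent if its two orderings are. -/
def HamelSpace.IsIndependent {C G : Type*} [Field C] [LinearOrder C] [AddCommGroup G]
    [Module C G] (H : HamelSpace C G) : Prop :=
  H.toMultiOrder.IsIndependent

/-- A Hamel space is dense if the values are dense with respect to `<₀`. -/
def HamelSpace.IsDense {C G : Type*} [Field C] [LinearOrder C] [AddCommGroup G]
    [Module C G] (H : HamelSpace C G) : Prop :=
  ∀ a b : G, H.lt 0 a b →
    ∃ c : G, topLT (H.lt 0) (a : WithTop G) (H.v c) ∧ topLT (H.lt 0) (H.v c) (b : WithTop G)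

/-! ### The language -/

/-- The function symbols `0, ∞, +, (λ_c)_{c ∈ C}, v`. -/
inductive HamFunc (C : Type u) : ℕ → Type u
  | zero : HamFunc C 0
  | infty : HamFunc C 0
  | add : HamFunc C 2
  | smul (c : C) : HamFunc C 1
  | val : HamFunc C 1

/-- The relation symbols `<₀, <₁`. -/
inductive HamRel : ℕ → Type
  | lt (i : Fin 2) : HamRel 2

/-- The language of Hamel spaces over `C`. -/
def LHam (C : Type u) : FirstOrder.Language.{u, 0} := ⟨HamFunc C, HamRel⟩

/-- The underlying set `G ∪ {∞}` of the first-order structure attached to a Hamel space. -/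
def HamelSpace.Carrier {C G : Type*} [Field C] [LinearOrder C] [AddCommGroup G] [Module C G]
    (_H : HamelSpace C G) : Type _ := WithTop G

/-- A Hamel space as a structure with underlying set `G ∪ {∞}`, with `∞` as default value. -/
instance HamelSpace.instStructure {C : Type u} {G : Type w} [Field C] [LinearOrder C]
    [AddCommGroup G] [Module C G] (H : HamelSpace C G) : (LHam C).Structure H.Carrier where
  funMap := fun {_} f => match f with
    | HamFunc.zero => fun _ => ((0 : G) : WithTop G)
    | HamFunc.infty => fun _ => (⊤ : WithTop G)
    | HamFunc.add => fun x : Fin 2 → WithTop G => x 0 + x 1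
    | HamFunc.smul c => fun x : Fin 1 → WithTop G => WithTop.map (fun g : G => c • g) (x 0)
    | HamFunc.val => fun x : Fin 1 → WithTop G => topVal H.v (x 0)
  RelMap := fun {_} r => match r with
    | HamRel.lt i => fun x : Fin 2 → WithTop G => topLT (H.lt i) (x 0) (x 1)

/-! ### The theory -/

section Terms

variable {C : Type u} {α : Type w}

/-- The term `0`. -/
def zeroT : (LHam C).Term α := FirstOrder.Language.Constants.term (L := LHam C) HamFunc.zero

/-- The term `∞`. -/
def inftyT : (LHam C).Term α := FirstOrder.Language.Constants.term (L := LHam C) HamFunc.infty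

/-- The term `s + t`. -/
def addT (s t : (LHam C).Term α) : (LHam C).Term α :=
  FirstOrder.Language.Functions.apply₂ (L := LHam C) HamFunc.add s t

/-- The term `λ_c t`. -/
def smulT (c : C) (t : (LHam C).Term α) : (LHam C).Term α :=
  FirstOrder.Language.Functions.apply₁ (L := LHam C) (HamFunc.smul c) t

/-- The term `v t`. -/
def valT (t : (LHam C).Term α) : (LHam C).Term α :=
  FirstOrder.Language.Functions.apply₁ (L := LHam C) HamFunc.val t

/-- The formula `s <_i t`. -/
def ltF {n : ℕ} (i : Fin 2) (s t : (LHam C).Term (α ⊕ Fin n)) : (LHam C).BoundedFormula α n :=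
  FirstOrder.Language.Relations.boundedFormula₂ (L := LHam C) (HamRel.lt i) s t

/-- The formula `s ≤_i t`. -/
def leF {n : ℕ} (i : Fin 2) (s t : (LHam C).Term (α ⊕ Fin n)) : (LHam C).BoundedFormula α n :=
  ltF i s t ⊔ (s =' t)

/-- The formula `t ≠ ∞`. -/
def finF {n : ℕ} (t : (LHam C).Term (α ⊕ Fin n)) : (LHam C).BoundedFormula α n :=
  ∼(t =' inftyT)

end Terms

/-- The axioms for independent and dense Hamel spaces, with `∞` added as default value. -/
inductive IsAxiom (C : Type u) [Field C] [LinearOrder C] : (LHam C).Sentence → Prop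
  -- `G` is a `C`-vector space, and `∞` is a default value
  | add_assoc : IsAxiom C (∀' ∀' ∀' (addT (addT &0 &1) &2 =' addT &0 (addT &1 &2)))
  | add_comm : IsAxiom C (∀' ∀' (addT &0 &1 =' addT &1 &0))
  | zero_add : IsAxiom C (∀' (addT zeroT &0 =' &0))
  | add_neg : IsAxiom C (∀' (finF &0 ⟹ (addT &0 (smulT (-1) &0) =' zeroT)))
  | add_infty : IsAxiom C (∀' (addT &0 inftyT =' inftyT))
  | zero_fin : IsAxiom C (finF zeroT)
  | add_fin : IsAxiom C (∀' ∀' (finF &0 ⟹ finF &1 ⟹ finF (addT &0 &1)))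
  | smul_fin (c : C) : IsAxiom C (∀' (finF &0 ⟹ finF (smulT c &0)))
  | smul_infty (c : C) : IsAxiom C (smulT c inftyT =' inftyT)
  | smul_add (c : C) : IsAxiom C (∀' ∀' (smulT c (addT &0 &1) =' addT (smulT c &0) (smulT c &1)))
  | add_smul (c d : C) : IsAxiom C (∀' (smulT (c + d) &0 =' addT (smulT c &0) (smulT d &0)))
  | mul_smul (c d : C) : IsAxiom C (∀' (smulT (c * d) &0 =' smulT c (smulT d &0)))
  | one_smul : IsAxiom C (∀' (smulT 1 &0 =' &0))
  -- each `<_i` is a total ordering with largest element `∞`, making `G` an ordered vector space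
  | lt_irrefl (i : Fin 2) : IsAxiom C (∀' ∼(ltF i &0 &0))
  | lt_trans (i : Fin 2) : IsAxiom C (∀' ∀' ∀' (ltF i &0 &1 ⟹ ltF i &1 &2 ⟹ ltF i &0 &2))
  | lt_total (i : Fin 2) : IsAxiom C (∀' ∀' (ltF i &0 &1 ⊔ ((&0 =' &1) ⊔ ltF i &1 &0)))
  | lt_infty (i : Fin 2) : IsAxiom C (∀' (finF &0 ⟹ ltF i &0 inftyT))
  | add_lt_add (i : Fin 2) :
      IsAxiom C (∀' ∀' ∀' (finF &2 ⟹ ltF i &0 &1 ⟹ ltF i (addT &0 &2) (addT &1 &2)))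
  | smul_pos (i : Fin 2) (c : C) (hc : 0 < c) :
      IsAxiom C (∀' (ltF i zeroT &0 ⟹ ltF i zeroT (smulT c &0)))
  -- `v` is a Hamel valuation
  | v_infty : IsAxiom C (valT inftyT =' inftyT)
  | v_zero : IsAxiom C (valT zeroT =' inftyT)
  | v_fin : IsAxiom C (∀' (finF &0 ⟹ ∼(&0 =' zeroT) ⟹ finF (valT &0)))
  | v_add : IsAxiom C (∀' ∀' (leF 0 (valT &0) (valT (addT &0 &1)) ⊔
      leF 0 (valT &1) (valT (addT &0 &1))))
  | v_smul (c : C) (hc : c ≠ 0) : IsAxiom C (∀' (valT (smulT c &0) =' valT &0))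
  | v_convex : IsAxiom C (∀' ∀' (finF &1 ⟹ ltF 1 zeroT &0 ⟹ ltF 1 &0 &1 ⟹
      leF 0 (valT &1) (valT &0)))
  | v_idem : IsAxiom C (∀' (valT (valT &0) =' valT &0))
  | v_pos : IsAxiom C (∀' (ltF 1 zeroT (valT &0)))
  -- independence and density
  | indep : IsAxiom C (∀' ∀' ∀' ∀' (ltF 0 &0 &1 ⟹ ltF 1 &2 &3 ⟹
      ∃' (ltF 0 &0 &4 ⊓ (ltF 0 &4 &1 ⊓ (ltF 1 &2 &4 ⊓ ltF 1 &4 &3)))))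
  | dense : IsAxiom C (∀' ∀' (finF &1 ⟹ ltF 0 &0 &1 ⟹
      ∃' (ltF 0 &0 (valT &2) ⊓ ltF 0 (valT &2) &1)))

/-- The theory of independent and dense Hamel spaces over `C`. -/
def THam (C : Type u) [Field C] [LinearOrder C] : (LHam C).Theory := {φ | IsAxiom C φ}

/-- A theory admits quantifier elimination if every formula in finitely many free variables is
equivalent, modulo the theory, to a quantifier-free formula in the same variables. -/
def HasQuantifierElimination {L : FirstOrder.Language.{u, w}} (T : L.Theory) : Prop :=
  ∀ (n : ℕ) (φ : L.Formula (Fin n)),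
    ∃ ψ : L.Formula (Fin n), ψ.IsQF ∧ T ⊨ᵇ φ.iff ψ

/-! ### The models of the theory -/

/-- The axioms, spelled out in a structure. -/
structure Ax (C : Type u) [Field C] [LinearOrder C] {M : Type w} (z t : M) (ad : M → M → M)
    (sm : C → M → M) (v : M → M) (lt : Fin 2 → M → M → Prop) : Prop where
  add_assoc : ∀ x y w, ad (ad x y) w = ad x (ad y w)
  add_comm : ∀ x y, ad x y = ad y x
  zero_add : ∀ x, ad z x = x
  add_neg : ∀ x, x ≠ t → ad x (sm (-1) x) = z
  add_infty : ∀ x, ad x t = t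
  zero_fin : z ≠ t
  add_fin : ∀ x y, x ≠ t → y ≠ t → ad x y ≠ t
  smul_fin : ∀ c x, x ≠ t → sm c x ≠ t
  smul_infty : ∀ c, sm c t = t
  smul_add : ∀ c x y, sm c (ad x y) = ad (sm c x) (sm c y)
  add_smul : ∀ c d x, sm (c + d) x = ad (sm c x) (sm d x)
  mul_smul : ∀ c d x, sm (c * d) x = sm c (sm d x)
  one_smul : ∀ x, sm 1 x = x
  lt_irrefl : ∀ i x, ¬ lt i x x
  lt_trans : ∀ i x y w, lt i x y → lt i y w → lt i x w
  lt_total : ∀ i x y, lt i x y ∨ x = y ∨ lt i y x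
  lt_infty : ∀ i x, x ≠ t → lt i x t
  add_lt_add : ∀ i x y w, w ≠ t → lt i x y → lt i (ad x w) (ad y w)
  smul_pos : ∀ i c, 0 < c → ∀ x, lt i z x → lt i z (sm c x)
  v_infty : v t = t
  v_zero : v z = t
  v_fin : ∀ x, x ≠ t → x ≠ z → v x ≠ t
  v_add : ∀ x y, (lt 0 (v x) (v (ad x y)) ∨ v x = v (ad x y)) ∨
    (lt 0 (v y) (v (ad x y)) ∨ v y = v (ad x y))
  v_smul : ∀ c, c ≠ 0 → ∀ x, v (sm c x) = v x
  v_convex : ∀ x y, y ≠ t → lt 1 z x → lt 1 x y → lt 0 (v y) (v x) ∨ v y = v x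
  v_idem : ∀ x, v (v x) = v x
  v_pos : ∀ x, lt 1 z (v x)
  indep : ∀ a b c d, lt 0 a b → lt 1 c d → ∃ e, lt 0 a e ∧ lt 0 e b ∧ lt 1 c e ∧ lt 1 e d
  dense : ∀ a b, b ≠ t → lt 0 a b → ∃ c, lt 0 a (v c) ∧ lt 0 (v c) b

section Realize

open FirstOrder.Language

variable {C : Type u} {M : Type w} [(LHam C).Structure M]

/-- Interpretation of `0`. -/
def mzero (C : Type u) (M : Type w) [(LHam C).Structure M] : M :=
  Structure.funMap (L := LHam C) (M := M) HamFunc.zero ![]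
/-- Interpretation of `∞`. -/
def minfty (C : Type u) (M : Type w) [(LHam C).Structure M] : M :=
  Structure.funMap (L := LHam C) (M := M) HamFunc.infty ![]
/-- Interpretation of `+`. -/
def madd (C : Type u) {M : Type w} [(LHam C).Structure M] (x y : M) : M :=
  Structure.funMap (L := LHam C) (M := M) HamFunc.add ![x, y]
/-- Interpretation of `λ_c`. -/
def msmul {C : Type u} {M : Type w} [(LHam C).Structure M] (c : C) (x : M) : M :=
  Structure.funMap (L := LHam C) (M := M) (HamFunc.smul c) ![x]
/-- Interpretation of `v`. -/
def mval (C : Type u) {M : Type w} [(LHam C).Structure M] (x : M) : M :=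
  Structure.funMap (L := LHam C) (M := M) HamFunc.val ![x]
/-- Interpretation of `<_i`. -/
def mlt (C : Type u) {M : Type w} [(LHam C).Structure M] (i : Fin 2) (x y : M) : Prop :=
  Structure.RelMap (L := LHam C) (M := M) (HamRel.lt i) ![x, y]

variable {α : Type*} (e : α → M)

theorem realize_zeroT : (zeroT : (LHam C).Term α).realize e = mzero C M := by
  simp only [zeroT, mzero, Constants.term, Term.realize]
  congr 1; exact Subsingleton.elim _ _
theorem realize_inftyT : (inftyT : (LHam C).Term α).realize e = minfty C M := by
  simp only [inftyT, minfty, Constants.term, Term.realize]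
  congr 1; exact Subsingleton.elim _ _
theorem realize_addT (s t : (LHam C).Term α) :
    (addT s t).realize e = madd C (s.realize e) (t.realize e) := by
  exact Term.realize_functions_apply₂ (L := LHam C)
theorem realize_smulT (c : C) (t : (LHam C).Term α) :
    (smulT c t).realize e = msmul c (t.realize e) := by
  exact Term.realize_functions_apply₁ (L := LHam C)
theorem realize_valT (t : (LHam C).Term α) :
    (valT t).realize e = mval C (t.realize e) := by
  exact Term.realize_functions_apply₁ (L := LHam C)

variable {n : ℕ} (xs : Fin n → M)

theorem realize_ltF (i : Fin 2) (s t : (LHam C).Term (α ⊕ Fin n)) :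
    (ltF i s t).Realize e xs ↔
      mlt C i (s.realize (Sum.elim e xs)) (t.realize (Sum.elim e xs)) := by
  exact BoundedFormula.realize_rel₂ (L := LHam C)
theorem realize_leF (i : Fin 2) (s t : (LHam C).Term (α ⊕ Fin n)) :
    (leF i s t).Realize e xs ↔
      mlt C i (s.realize (Sum.elim e xs)) (t.realize (Sum.elim e xs)) ∨
        s.realize (Sum.elim e xs) = t.realize (Sum.elim e xs) := by
  simp only [leF, BoundedFormula.realize_sup, realize_ltF, BoundedFormula.realize_bdEqual]
theorem realize_finF (t : (LHam C).Term (α ⊕ Fin n)) :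
    (finF t).Realize e xs ↔ t.realize (Sum.elim e xs) ≠ minfty C M := by
  simp only [finF, BoundedFormula.realize_not, BoundedFormula.realize_bdEqual, realize_inftyT, ne_eq]

attribute [local simp] Sentence.Realize Formula.Realize Fin.snoc realize_zeroT realize_inftyT
  realize_addT realize_smulT realize_valT realize_ltF realize_leF realize_finF or_assoc

theorem models_iff_ax [Field C] [LinearOrder C] :
    M ⊨ THam C ↔
      Ax C (mzero C M) (minfty C M) (madd C) msmul (mval C) (mlt C (M := M)) := by
  have key : M ⊨ THam C ↔ ∀ φ, IsAxiom C φ → M ⊨ φ := Theory.model_iff _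
  rw [key]
  constructor
  · intro h
    constructor
    case add_assoc =>
      simpa using h _ IsAxiom.add_assoc
    case add_comm =>
      simpa using h _ IsAxiom.add_comm
    case zero_add =>
      simpa using h _ IsAxiom.zero_add
    case add_neg =>
      simpa using h _ IsAxiom.add_neg
    case add_infty =>
      simpa using h _ IsAxiom.add_infty
    case zero_fin =>
      simpa using h _ IsAxiom.zero_fin
    case add_fin =>
      simpa using h _ IsAxiom.add_fin
    case smul_fin =>
      intro c
      simpa using h _ (IsAxiom.smul_fin c)
    case smul_infty =>
      intro c
      simpa using h _ (IsAxiom.smul_infty c)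
    case smul_add =>
      intro c
      simpa using h _ (IsAxiom.smul_add c)
    case add_smul =>
      intro c d
      simpa using h _ (IsAxiom.add_smul c d)
    case mul_smul =>
      intro c d
      simpa using h _ (IsAxiom.mul_smul c d)
    case one_smul =>
      simpa using h _ IsAxiom.one_smul
    case lt_irrefl =>
      intro i
      simpa using h _ (IsAxiom.lt_irrefl i)
    case lt_trans =>
      intro i
      simpa using h _ (IsAxiom.lt_trans i)
    case lt_total =>
      intro i
      simpa using h _ (IsAxiom.lt_total i)
    case lt_infty =>
      intro i
      simpa using h _ (IsAxiom.lt_infty i)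
    case add_lt_add =>
      intro i
      simpa using h _ (IsAxiom.add_lt_add i)
    case smul_pos =>
      intro i c hc
      simpa using h _ (IsAxiom.smul_pos i c hc)
    case v_infty =>
      simpa using h _ IsAxiom.v_infty
    case v_zero =>
      simpa using h _ IsAxiom.v_zero
    case v_fin =>
      simpa using h _ IsAxiom.v_fin
    case v_add =>
      simpa using h _ IsAxiom.v_add
    case v_smul =>
      intro c hc
      simpa using h _ (IsAxiom.v_smul c hc)
    case v_convex =>
      simpa using h _ IsAxiom.v_convex
    case v_idem =>
      simpa using h _ IsAxiom.v_idem
    case v_pos =>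
      simpa using h _ IsAxiom.v_pos
    case indep =>
      simpa using h _ IsAxiom.indep
    case dense =>
      simpa using h _ IsAxiom.dense
  · intro h φ hφ
    cases hφ
    case add_assoc =>
      simpa using h.add_assoc
    case add_comm =>
      simpa using h.add_comm
    case zero_add =>
      simpa using h.zero_add
    case add_neg =>
      simpa using h.add_neg
    case add_infty =>
      simpa using h.add_infty
    case zero_fin =>
      simpa using h.zero_fin
    case add_fin =>
      simpa using h.add_fin
    case smul_fin c =>
      simpa using h.smul_fin c
    case smul_infty c =>
      simpa using h.smul_infty c
    case smul_add c =>
      simpa using h.smul_add c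
    case add_smul c d =>
      simpa using h.add_smul c d
    case mul_smul c d =>
      simpa using h.mul_smul c d
    case one_smul =>
      simpa using h.one_smul
    case lt_irrefl i =>
      simpa using h.lt_irrefl i
    case lt_trans i =>
      simpa using h.lt_trans i
    case lt_total i =>
      simpa using h.lt_total i
    case lt_infty i =>
      simpa using h.lt_infty i
    case add_lt_add i =>
      simpa using h.add_lt_add i
    case smul_pos i c hc =>
      simpa using h.smul_pos i c hc
    case v_infty =>
      simpa using h.v_infty
    case v_zero =>
      simpa using h.v_zero
    case v_fin =>
      simpa using h.v_fin
    case v_add =>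
      simpa using h.v_add
    case v_smul c hc =>
      simpa using h.v_smul c hc
    case v_convex =>
      simpa using h.v_convex
    case v_idem =>
      simpa using h.v_idem
    case v_pos =>
      simpa using h.v_pos
    case indep =>
      simpa using h.indep
    case dense =>
      simpa using h.dense

end Realize

section Orders

variable {S : Type w} (r : S → S → Prop)

theorem topLT_coe (a b : S) : topLT r (a : WithTop S) (b : WithTop S) ↔ r a b := by
  let _ : LT S := ⟨r⟩
  exact WithTop.coe_lt_coe

theorem topLT_top (a : S) : topLT r (a : WithTop S) ⊤ := by
  let _ : LT S := ⟨r⟩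
  exact WithTop.coe_lt_top a

theorem not_top_topLT (a : WithTop S) : ¬ topLT r ⊤ a := by
  let _ : LT S := ⟨r⟩
  exact WithTop.not_top_lt _

theorem botTopLT_coe (a b : WithTop S) :
    botTopLT r (a : WithBot (WithTop S)) (b : WithBot (WithTop S)) ↔ topLT r a b := by
  let _ : LT S := ⟨r⟩
  exact WithBot.coe_lt_coe

theorem botTopLT_bot (a : WithTop S) : botTopLT r ⊥ (a : WithBot (WithTop S)) := by
  let _ : LT S := ⟨r⟩
  exact WithBot.bot_lt_coe a

theorem not_botTopLT_bot (a : WithBot (WithTop S)) : ¬ botTopLT r a ⊥ := by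
  let _ : LT S := ⟨r⟩
  exact WithBot.not_lt_bot _

end Orders

section Models

variable {C : Type u} {G : Type w} [Field C] [LinearOrder C] [AddCommGroup G] [Module C G]

/-- Independence of two orderings in terms of one interval with endpoints in `G ∪ {∞}` for each
of them. -/
theorem HamelSpace.isIndependent_iff (H : HamelSpace C G) :
    H.IsIndependent ↔ ∀ a b c d : WithTop G, topLT (H.lt 0) a b → topLT (H.lt 1) c d →
      ∃ e : G, topLT (H.lt 0) a e ∧ topLT (H.lt 0) e b ∧ topLT (H.lt 1) c e ∧
        topLT (H.lt 1) e d := by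
  constructor
  · intro h a b c d hab hcd
    obtain ⟨e, he⟩ := h Finset.univ ![(a : WithBot (WithTop G)), (c : WithBot (WithTop G))]
      ![(b : WithBot (WithTop G)), (d : WithBot (WithTop G))] (by
        intro i _
        fin_cases i
        · exact (botTopLT_coe _ _ _).2 hab
        · exact (botTopLT_coe _ _ _).2 hcd)
    simp only [Set.mem_iInter] at he
    have h0 := he 0 (Finset.mem_univ _)
    have h1 := he 1 (Finset.mem_univ _)
    exact ⟨e, (botTopLT_coe _ _ _).1 h0.1, (botTopLT_coe _ _ _).1 h0.2,
      (botTopLT_coe _ _ _).1 h1.1, (botTopLT_coe _ _ _).1 h1.2⟩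
  · intro h J a b hab
    obtain ⟨e, he0, -, he1, -⟩ := h ((0 : G) : WithTop G) ⊤ ((0 : G) : WithTop G) ⊤
      (topLT_top _ _) (topLT_top _ _)
    have he : ∀ i, H.lt i 0 e := by
      intro i
      fin_cases i
      · exact (topLT_coe _ _ _).1 he0
      · exact (topLT_coe _ _ _).1 he1
    have key : ∀ i, ∃ p q : WithTop G, topLT (H.lt i) p q ∧ ∀ s : G, i ∈ J →
        topLT (H.lt i) p s → topLT (H.lt i) s q → s ∈ interval (H.lt i) (a i) (b i) := by
      intro i
      by_cases hi : i ∈ J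
      · have hl := hab i hi
        unfold interval
        generalize a i = x at hl ⊢
        generalize b i = y at hl ⊢
        induction y using WithBot.recBotCoe with
        | bot => exact absurd hl (not_botTopLT_bot _ _)
        | coe y =>
          induction x using WithBot.recBotCoe with
          | coe x =>
            exact ⟨x, y, (botTopLT_coe _ _ _).1 hl, fun s _ h1 h2 =>
              ⟨(botTopLT_coe _ _ _).2 h1, (botTopLT_coe _ _ _).2 h2⟩⟩
          | bot =>
            obtain ⟨p, hp⟩ : ∃ p : WithTop G, topLT (H.lt i) p y := by
              induction y using WithTop.recTopCoe with
              | top => exact ⟨((0 : G) : WithTop G), topLT_top _ _⟩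
              | coe g =>
                refine ⟨((g - e : G) : WithTop G), (topLT_coe _ _ _).2 ?_⟩
                have := H.add_lt_add i 0 e (g - e) (he i)
                simpa using this
            exact ⟨p, y, hp, fun s _ _ h2 =>
              ⟨botTopLT_bot _ _, (botTopLT_coe _ _ _).2 h2⟩⟩
      · exact ⟨((0 : G) : WithTop G), ⊤, topLT_top _ _, fun s h => absurd h hi⟩
    choose p q hpq hs using key
    obtain ⟨s, h1, h2, h3, h4⟩ := h _ _ _ _ (hpq 0) (hpq 1)
    refine ⟨s, ?_⟩
    simp only [Set.mem_iInter]
    intro i hi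
    fin_cases i
    · exact hs 0 s hi h1 h2
    · exact hs 1 s hi h3 h4

/-- The axioms hold in an independent and dense Hamel space. -/
theorem HamelSpace.models (H : HamelSpace C G) (hi : H.IsIndependent) (hd : H.IsDense) :
    H.Carrier ⊨ THam C := by
  rw [models_iff_ax]
  rw [HamelSpace.isIndependent_iff] at hi
  change Ax C (M := WithTop G) ((0 : G) : WithTop G) ⊤ (fun x y => x + y)
    (fun c => WithTop.map (fun g : G => c • g)) (topVal H.v) (fun i => topLT (H.lt i))
  have := H.strictTotal
  constructor
  case add_assoc => exact _root_.add_assoc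
  case add_comm => exact _root_.add_comm
  case zero_add => exact _root_.zero_add
  case add_neg =>
    simp only [WithTop.forall, ne_eq, not_true_eq_false, false_imp_iff, true_and, WithTop.map_coe,
      ← WithTop.coe_add, WithTop.coe_inj, neg_smul, MulAction.one_smul]
    exact fun x _ => add_neg_cancel x
  case add_infty => simp
  case zero_fin => simp
  case add_fin => simp [WithTop.forall]
  case smul_fin => simp
  case smul_infty => exact fun c => rfl
  case smul_add => simp [WithTop.forall, ← WithTop.coe_add]
  case add_smul => simp [WithTop.forall, ← WithTop.coe_add, _root_.add_smul]
  case mul_smul => simp [WithTop.forall, SemigroupAction.mul_smul]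
  case one_smul => simp [WithTop.forall]
  case lt_irrefl =>
    simp only [WithTop.forall, topLT_coe, not_top_topLT, not_false_eq_true, true_and]
    exact fun i a => irrefl_of (H.lt i) a
  case lt_trans =>
    simp only [WithTop.forall, topLT_coe, topLT_top, not_top_topLT, false_imp_iff, imp_true_iff,
      true_and, and_true]
    exact fun i a b c => trans_of (H.lt i)
  case lt_total =>
    simp only [WithTop.forall, topLT_coe, topLT_top, not_top_topLT, or_true, true_or, imp_true_iff,
      true_and, and_true, WithTop.coe_inj]
    exact fun i a b => trichotomous_of (H.lt i) a b
  case lt_infty => simp [WithTop.forall, topLT_top]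
  case add_lt_add =>
    simp only [WithTop.forall, topLT_coe, topLT_top, not_top_topLT, false_imp_iff, imp_true_iff,
      true_and, and_true, ne_eq, not_true_eq_false, WithTop.coe_ne_top, not_false_eq_true,
      true_imp_iff, WithTop.top_add, ← WithTop.coe_add]
    exact fun i a b c => H.add_lt_add i a b c
  case smul_pos =>
    simp only [WithTop.forall, topLT_coe, topLT_top, WithTop.map_top, WithTop.map_coe,
      imp_true_iff, true_and]
    exact fun i c hc x => H.smul_pos i c x hc
  case v_infty => rfl
  case v_zero => exact (H.v_eq_top 0).2 rfl
  case v_fin =>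
    simp only [WithTop.forall, ne_eq, not_true_eq_false, false_imp_iff, true_and,
      WithTop.coe_inj]
    exact fun a _ h h' => h ((H.v_eq_top a).1 h')
  case v_add =>
    have htop : ∀ x : WithTop G, topLT (H.lt 0) x ⊤ ∨ x = ⊤ := by
      simp [WithTop.forall, topLT_top]
    intro x y
    induction x using WithTop.recTopCoe with
    | top => exact Or.inl (htop _)
    | coe x =>
      induction y using WithTop.recTopCoe with
      | top => exact Or.inl (htop _)
      | coe y => exact H.v_add x y
  case v_smul =>
    intro c hc x
    induction x using WithTop.recTopCoe with
    | top => rfl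
    | coe x => exact H.v_smul c x hc
  case v_convex =>
    simp only [WithTop.forall, topLT_coe, not_top_topLT, ne_eq, not_true_eq_false, false_imp_iff,
      imp_true_iff, true_and]
    exact fun x y _ => H.v_convex x y
  case v_idem =>
    intro x
    induction x using WithTop.recTopCoe with
    | top => rfl
    | coe x => exact H.v_idem x
  case v_pos =>
    intro x
    induction x using WithTop.recTopCoe with
    | top => exact topLT_top _ _
    | coe x => exact H.v_pos x
  case indep =>
    intro a b c d h1 h2
    obtain ⟨e, he⟩ := hi a b c d h1 h2
    exact ⟨e, he⟩
  case dense =>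
    simp only [WithTop.forall, ne_eq, not_true_eq_false, false_imp_iff, true_and, not_top_topLT,
      imp_true_iff, topLT_coe]
    intro a b _ h
    obtain ⟨c, hc⟩ := hd a b h
    exact ⟨c, hc⟩

section Construct

variable {M : Type w} {z t : M} {ad : M → M → M} {sm : C → M → M} {v : M → M}
  {lt : Fin 2 → M → M → Prop}

/-- The group of finite elements. -/
abbrev Ax.group (A : Ax C z t ad sm v lt) : AddCommGroup {x : M // x ≠ t} :=
  letI : Zero {x : M // x ≠ t} := ⟨⟨z, A.zero_fin⟩⟩
  letI : Add {x : M // x ≠ t} := ⟨fun x y => ⟨ad x y, A.add_fin _ _ x.2 y.2⟩⟩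
  letI : Neg {x : M // x ≠ t} := ⟨fun x => ⟨sm (-1) x, A.smul_fin _ _ x.2⟩⟩
  { add_assoc := fun x y w => Subtype.ext (A.add_assoc _ _ _)
    add_comm := fun x y => Subtype.ext (A.add_comm _ _)
    zero_add := fun x => Subtype.ext (A.zero_add _)
    add_zero := fun x => Subtype.ext ((A.add_comm _ _).trans (A.zero_add _))
    neg_add_cancel := fun x => Subtype.ext ((A.add_comm _ _).trans (A.add_neg _ x.2))
    nsmul := nsmulRec
    zsmul := zsmulRec }

/-- The vector space of finite elements. -/
abbrev Ax.module (A : Ax C z t ad sm v lt) :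
    letI := A.group
    Module C {x : M // x ≠ t} :=
  letI := A.group
  letI : SMul C {x : M // x ≠ t} := ⟨fun c x => ⟨sm c x, A.smul_fin _ _ x.2⟩⟩
  Module.ofMinimalAxioms
    (fun _ _ _ => Subtype.ext (A.smul_add _ _ _))
    (fun _ _ _ => Subtype.ext (A.add_smul _ _ _))
    (fun _ _ _ => Subtype.ext (A.mul_smul _ _ _))
    (fun _ => Subtype.ext (A.one_smul _))

open Classical in
/-- The elements of `M`, as finite elements together with `∞`. -/
noncomputable def toTop (t : M) : M ≃ WithTop {x : M // x ≠ t} where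
  toFun x := if h : x = t then ⊤ else ((⟨x, h⟩ : {x : M // x ≠ t}) : WithTop _)
  invFun := WithTop.recTopCoe t Subtype.val
  left_inv x := by
    by_cases h : x = t
    · simp [h]
    · simp [h]
  right_inv x := by
    induction x using WithTop.recTopCoe with
    | top => simp
    | coe x => simp [x.2]

theorem toTop_self (t : M) : toTop t t = ⊤ := by simp [toTop]

theorem toTop_coe (t : M) (x : {x : M // x ≠ t}) : toTop t x = x := by
  simp [toTop, x.2]

theorem Ax.topLT_toTop (A : Ax C z t ad sm v lt) (i : Fin 2) (x y : M) :
    topLT (fun a b : {x : M // x ≠ t} => lt i a b) (toTop t x) (toTop t y) ↔ lt i x y := by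
  by_cases hx : x = t
  · subst hx
    rw [toTop_self]
    refine iff_of_false (not_top_topLT _ _) fun h => ?_
    by_cases hy : y = x
    · exact A.lt_irrefl i _ (hy ▸ h)
    · exact A.lt_irrefl i _ (A.lt_trans i _ _ _ h (A.lt_infty i _ hy))
  · lift x to {x : M // x ≠ t} using hx
    by_cases hy : y = t
    · subst hy
      rw [toTop_self, toTop_coe]
      exact iff_of_true (topLT_top _ _) (A.lt_infty i _ x.2)
    · lift y to {x : M // x ≠ t} using hy
      rw [toTop_coe, toTop_coe, topLT_coe]

theorem Ax.topLE_toTop (A : Ax C z t ad sm v lt) (i : Fin 2) (x y : M) :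
    topLE (fun a b : {x : M // x ≠ t} => lt i a b) (toTop t x) (toTop t y) ↔
      lt i x y ∨ x = y := by
  rw [topLE, A.topLT_toTop, (toTop t).injective.eq_iff]

theorem Ax.topVal_toTop (A : Ax C z t ad sm v lt) (x : M) :
    topVal (fun a : {x : M // x ≠ t} => toTop t (v a)) (toTop t x) = toTop t (v x) := by
  by_cases hx : x = t
  · subst hx
    rw [A.v_infty, toTop_self]
    rfl
  · lift x to {x : M // x ≠ t} using hx
    rw [toTop_coe]
    rfl

/-- The Hamel space of finite elements. -/
noncomputable abbrev Ax.hamelSpace (A : Ax C z t ad sm v lt) :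
    letI := A.group
    letI := A.module
    HamelSpace C {x : M // x ≠ t} :=
  letI := A.group
  letI := A.module
  { lt := fun i a b => lt i a b
    strictTotal := fun i =>
      { trichotomous := fun a b h1 h2 => by
          rcases A.lt_total i a b with h | h | h
          · exact absurd h h1
          · exact Subtype.ext h
          · exact absurd h h2
        irrefl := fun a => A.lt_irrefl i a
        trans := fun a b c => A.lt_trans i a b c }
    add_lt_add := fun i x y w => A.add_lt_add i x y w w.2
    smul_pos := fun i c x hc => A.smul_pos i c hc x
    v := fun a => toTop t (v a)
    v_eq_top := fun x => by
      rw [← toTop_self t, (toTop t).injective.eq_iff]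
      constructor
      · intro h
        by_contra h'
        exact A.v_fin x x.2 (fun h2 => h' (Subtype.ext h2)) h
      · intro h
        subst h
        exact A.v_zero
    v_add := fun x y => by
      rw [A.topLE_toTop, A.topLE_toTop]
      exact A.v_add x y
    v_smul := fun c x hc => congrArg (toTop t) (A.v_smul c hc x)
    v_convex := fun x y h1 h2 => (A.topLE_toTop 0 _ _).2 (A.v_convex x y y.2 h1 h2)
    v_idem := fun x => by rw [A.topVal_toTop, A.v_idem]
    v_pos := fun x => by
      have := (A.topLT_toTop 1 z (v x)).2 (A.v_pos x)
      rwa [toTop_coe t ⟨z, A.zero_fin⟩] at this }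

theorem Ax.isIndependent (A : Ax C z t ad sm v lt) :
    letI := A.group
    letI := A.module
    A.hamelSpace.IsIndependent := by
  let _ := A.group
  let _ := A.module
  refine (HamelSpace.isIndependent_iff _).2 ?_
  intro a b c d hab hcd
  obtain ⟨a, rfl⟩ := (toTop t).surjective a
  obtain ⟨b, rfl⟩ := (toTop t).surjective b
  obtain ⟨c, rfl⟩ := (toTop t).surjective c
  obtain ⟨d, rfl⟩ := (toTop t).surjective d
  obtain ⟨e, h1, h2, h3, h4⟩ :=
    A.indep a b c d ((A.topLT_toTop 0 _ _).1 hab) ((A.topLT_toTop 1 _ _).1 hcd)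
  have he : e ≠ t := by
    rintro rfl
    exact not_top_topLT _ _ (toTop_self e ▸ (A.topLT_toTop 0 _ _).2 h2)
  lift e to {x : M // x ≠ t} using he
  refine ⟨e, ?_⟩
  rw [← toTop_coe t e]
  exact ⟨(A.topLT_toTop 0 _ _).2 h1, (A.topLT_toTop 0 _ _).2 h2, (A.topLT_toTop 1 _ _).2 h3,
    (A.topLT_toTop 1 _ _).2 h4⟩

theorem Ax.isDense (A : Ax C z t ad sm v lt) :
    letI := A.group
    letI := A.module
    A.hamelSpace.IsDense := by
  let _ := A.group
  let _ := A.module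
  intro a b hab
  obtain ⟨c, h1, h2⟩ := A.dense a b b.2 hab
  have hc : c ≠ t := by
    rintro rfl
    rw [A.v_infty] at h2
    exact not_top_topLT _ _ (toTop_self c ▸ (A.topLT_toTop 0 _ _).2 h2)
  refine ⟨⟨c, hc⟩, ?_⟩
  rw [← toTop_coe t a, ← toTop_coe t b]
  exact ⟨(A.topLT_toTop 0 _ _).2 h1, (A.topLT_toTop 0 _ _).2 h2⟩

theorem Ax.toTop_add (A : Ax C z t ad sm v lt) (x y : M) :
    letI := A.group
    toTop t (ad x y) = toTop t x + toTop t y := by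
  let _ := A.group
  by_cases hy : y = t
  · subst hy
    rw [A.add_infty, toTop_self, WithTop.add_top]
  · by_cases hx : x = t
    · subst hx
      rw [A.add_comm, A.add_infty, toTop_self, WithTop.top_add]
    · lift x to {x : M // x ≠ t} using hx
      lift y to {x : M // x ≠ t} using hy
      rw [toTop_coe, toTop_coe]
      exact toTop_coe t (x + y)

theorem Ax.toTop_smul (A : Ax C z t ad sm v lt) (c : C) (x : M) :
    letI := A.group
    letI := A.module
    toTop t (sm c x) = WithTop.map (fun g : {x : M // x ≠ t} => c • g) (toTop t x) := by
  let _ := A.group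
  let _ := A.module
  by_cases hx : x = t
  · subst hx
    rw [A.smul_infty, toTop_self, WithTop.map_top]
  · lift x to {x : M // x ≠ t} using hx
    rw [toTop_coe]
    exact toTop_coe t (c • x)

end Construct

/-- The models of the theory are, up to isomorphism, precisely the independent and dense Hamel
spaces. -/
theorem models_iff (M : Type w) [(LHam C).Structure M] :
    M ⊨ THam C ↔ ∃ (G : Type w) (_ : AddCommGroup G) (_ : Module C G) (H : HamelSpace C G),
      H.IsIndependent ∧ H.IsDense ∧ Nonempty (M ≃[LHam C] H.Carrier) := by
  constructor
  · intro hM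
    have A := models_iff_ax.1 hM
    refine ⟨{x : M // x ≠ minfty C M}, A.group, A.module, A.hamelSpace, A.isIndependent, A.isDense,
      ⟨{ toEquiv := toTop (minfty C M), map_fun' := ?_, map_rel' := ?_ }⟩⟩
    · intro n f x
      cases f with
      | zero =>
        obtain rfl : x = ![] := Subsingleton.elim _ _
        exact toTop_coe (minfty C M) ⟨mzero C M, A.zero_fin⟩
      | infty =>
        obtain rfl : x = ![] := Subsingleton.elim _ _
        exact toTop_self (minfty C M)
      | add =>
        obtain ⟨a, b, rfl⟩ : ∃ a b, x = ![a, b] := ⟨x 0, x 1, by ext i; fin_cases i <;> rfl⟩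
        exact A.toTop_add a b
      | smul c =>
        obtain ⟨a, rfl⟩ : ∃ a, x = ![a] := ⟨x 0, by ext i; fin_cases i; rfl⟩
        exact A.toTop_smul c a
      | val =>
        obtain ⟨a, rfl⟩ : ∃ a, x = ![a] := ⟨x 0, by ext i; fin_cases i; rfl⟩
        exact (A.topVal_toTop a).symm
    · intro n r x
      cases r with
      | lt i =>
        obtain ⟨a, b, rfl⟩ : ∃ a b, x = ![a, b] := ⟨x 0, x 1, by ext i; fin_cases i <;> rfl⟩
        exact A.topLT_toTop i a b
  · rintro ⟨G, _, _, H, hi, hd, ⟨f⟩⟩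
    have := H.models hi hd
    exact FirstOrder.Language.StrongHomClass.theory_model f.symm

end Models
end Hamel

-- By compactness, quantifier elimination reduces to a transfer property (`exists_isQF_iff_of_ex`):
-- if two tuples in models M and N have the same quantifier-free type, a quantifier-free formula
-- solvable over the first tuple in M is solvable over the second in N. The tuples generate
-- isomorphic substructures, so there is a linear map f that respects both orderings and the
-- valuation on the `v`-closed subspace A generated by the first tuple.
--
-- An embedding of all of M into N extending f would require saturation of N, but a single formula
-- sees only finitely many elements. Embeddings are therefore replaced by `Approx`: a filter of
-- linear maps agreeing with f on A such that each vector of a subspace U is eventually preserved,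
-- in its signs and its value. `Approx.top` enlarges U from A to the whole space with Zorn's lemma.
-- Two kinds of one-dimensional extension suffice.
--
-- If γ is a value outside the `v`-closed U, no w in U has value γ, so one of γ and w dominates the
-- other. The value of γ - w and its sign for `<₁` are then forced, and only the `<₀`-cut of γ
-- matters. Density and independence provide a value of N in any finite part of that cut
-- (`Approx.sup_span_value`).
--
-- If U contains all values and b is outside U, then for finite W in U there is a `<₁`-interval with
-- endpoints in U, both of which look like b from W in `<₁` and in distances (`exists_fits`). By
-- convexity of the valuation the same is true of every point between their images, and independence
-- provides such a point in the required `<₀`-cut (`Approx.sup_span_of_values_mem`).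
--
-- Starting from A = 0, the same construction shows that quantifier-free sentences have the same
-- truth value in all models, so completeness only needs one model. That model comes from an ordered
-- vector space with an order-dense basis (`exists_dense_basis`): the basis vectors are the finite
-- values, and `<₁` is lexicographic in the coordinates.

universe v

namespace Hamel

/-! ### Model theory: a test for quantifier elimination. -/

section Criterion

open FirstOrder FirstOrder.Language

variable {L : FirstOrder.Language.{u, v}} {T : L.Theory} {α : Type} {n : ℕ}

/-- The compactness theorem for sets of formulas in given free variables. -/
theorem exists_realize_of_finite (Φ : Set (L.BoundedFormula α n))
    (h : ∀ s : Finset (L.BoundedFormula α n), (s : Set _) ⊆ Φ →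
      ∃ (M : Theory.ModelType.{u, v, max u v} T) (x : α → M) (y : Fin n → M),
        ∀ φ ∈ s, φ.Realize x y) :
    ∃ (M : Theory.ModelType.{u, v, max u v} T) (x : α → M) (y : Fin n → M),
      ∀ φ ∈ Φ, φ.Realize x y := by
  classical
  have h' : ∀ s : Finset Φ, ∃ (M : Theory.ModelType.{u, v, max u v} T) (x : α → M) (y : Fin n → M),
      ∀ φ ∈ s, φ.1.Realize x y := fun s => by
    obtain ⟨M, x, y, hM⟩ := h (s.map (Function.Embedding.subtype fun x => x ∈ Φ))
      s.map_subtype_subset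
    exact ⟨M, x, y, fun φ hφ => hM φ.1 (by simpa using hφ)⟩
  choose M x y hM using h'
  let U : Ultrafilter (Finset Φ) := Ultrafilter.of Filter.atTop
  let P := Filter.Product (U : Filter (Finset Φ)) (fun s => M s)
  have hP : P ⊨ T := by
    refine ⟨fun φ hφ => ?_⟩
    rw [Ultraproduct.sentence_realize]
    exact Filter.Eventually.of_forall fun s => Theory.realize_sentence_of_mem T hφ
  refine ⟨Theory.ModelType.of T P, fun i => ((fun s => x s i : ∀ s, M s) : P),
    fun i => ((fun s => y s i : ∀ s, M s) : P), fun φ hφ => ?_⟩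
  refine (Ultraproduct.boundedFormula_realize_cast φ (fun i s => x s i) (fun i s => y s i)).2 ?_
  refine Filter.Eventually.filter_mono (Ultrafilter.of_le _) (Filter.eventually_atTop.2
    ⟨{⟨φ, hφ⟩}, fun s hs => hM s ⟨φ, hφ⟩ (hs (Finset.mem_singleton_self _))⟩)

theorem exists_isQF_realize_iff_forall (s : Finset (L.BoundedFormula α n))
    (hs : ∀ φ ∈ s, φ.IsQF) : ∃ ψ : L.BoundedFormula α n, ψ.IsQF ∧
      ∀ (M : Type (max u v)) [L.Structure M] (x : α → M) (y : Fin n → M),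
        ψ.Realize x y ↔ ∀ φ ∈ s, φ.Realize x y := by
  refine ⟨s.toList.foldr (· ⊓ ·) ⊤, ?_, fun M _ x y => ?_⟩
  · have : ∀ l : List (L.BoundedFormula α n), (∀ φ ∈ l, φ.IsQF) →
        (l.foldr (· ⊓ ·) ⊤).IsQF := by
      intro l
      induction l with
      | nil => exact fun _ => BoundedFormula.IsQF.top
      | cons a l ih =>
        intro h
        exact (h a (by simp)).inf (ih fun φ hφ => h φ (by simp [hφ]))
    exact this _ fun φ hφ => hs φ (by simpa using hφ)
  · rw [BoundedFormula.realize_foldr_inf]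
    simp

/-- A formula whose truth is preserved between tuples of the same quantifier-free type is
equivalent to a quantifier-free formula. -/
theorem exists_isQF_iff (φ : L.BoundedFormula α n)
    (h : ∀ (M N : Theory.ModelType.{u, v, max u v} T) (x : α → M) (y : Fin n → M) (x' : α → N)
      (y' : Fin n → N),
      (∀ χ : L.BoundedFormula α n, χ.IsQF → χ.Realize x y → χ.Realize x' y') →
      φ.Realize x y → φ.Realize x' y') :
    ∃ ψ : L.BoundedFormula α n, ψ.IsQF ∧ T ⊨ᵇ φ.iff ψ := by
  classical
  by_contra hcon
  -- N satisfies `¬φ` and all quantifier-free consequences of φ. If these were inconsistent with T,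
  -- a conjunction of finitely many such consequences would imply φ and hence be equivalent to it.
  have h1 := exists_realize_of_finite (T := T) ({ψ | ψ.IsQF ∧ T ⊨ᵇ φ.imp ψ} ∪ {φ.not}) (by
    intro s hs
    obtain ⟨ψ, hψ, hr⟩ := exists_isQF_realize_iff_forall (s.erase φ.not) (by
      intro χ hχ
      obtain ⟨h1, h2⟩ := Finset.mem_erase.1 hχ
      rcases hs h2 with h3 | h3
      · exact h3.1
      · exact absurd h3 h1)
    by_contra hno
    push Not at hno
    refine hcon ⟨ψ, hψ, fun M x y => ?_⟩
    rw [BoundedFormula.realize_iff]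
    constructor
    · intro hφ
      refine (hr _ _ _).2 fun χ hχ => ?_
      obtain ⟨hne, hχs⟩ := Finset.mem_erase.1 hχ
      rcases hs hχs with h2 | h2
      · exact h2.2 M x y hφ
      · exact absurd h2 hne
    · intro hψ'
      obtain ⟨χ, hχ, hn⟩ := hno M x y
      by_cases hne : χ = φ.not
      · rw [hne] at hn
        simpa using hn
      · exact absurd ((hr _ _ _).1 hψ' χ (Finset.mem_erase.2 ⟨hne, hχ⟩)) hn)
  obtain ⟨N, x', y', hN⟩ := h1
  have hφN : ¬ φ.Realize x' y' := by simpa using hN φ.not (by simp)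
  -- M satisfies φ together with the quantifier-free type of the tuple in N. If some χ of that type
  -- excluded φ, then `¬χ` would be a consequence of φ and hold in N as well.
  have h2 := exists_realize_of_finite (T := T) ({χ | χ.IsQF ∧ χ.Realize x' y'} ∪ {φ}) (by
    intro s hs
    obtain ⟨χ, hχ, hr⟩ := exists_isQF_realize_iff_forall (s.erase φ) (by
      intro χ hχ
      obtain ⟨h1, h2⟩ := Finset.mem_erase.1 hχ
      rcases hs h2 with h3 | h3
      · exact h3.1
      · exact absurd h3 h1)
    by_contra hno
    push Not at hno
    have h3 : T ⊨ᵇ φ.imp χ.not := fun M x y => by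
      simp only [BoundedFormula.realize_imp, BoundedFormula.realize_not]
      intro hφ hχ'
      obtain ⟨θ, hθ, hn⟩ := hno M x y
      by_cases hθφ : θ = φ
      · exact hn (hθφ ▸ hφ)
      · exact hn ((hr _ _ _).1 hχ' θ (Finset.mem_erase.2 ⟨hθφ, hθ⟩))
    have h4 : ¬ χ.Realize x' y' := by simpa using hN χ.not (Or.inl ⟨hχ.not, h3⟩)
    refine h4 ((hr _ _ _).2 fun θ hθ => ?_)
    obtain ⟨h5, h6⟩ := Finset.mem_erase.1 hθ
    rcases hs h6 with h7 | h7
    · exact h7.2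
    · exact absurd h7 h5)
  obtain ⟨M, x, y, hM⟩ := h2
  refine hφN (h M N x y x' y' (fun χ hχ hr => ?_) (hM φ (by simp)))
  by_contra hn
  exact (BoundedFormula.realize_not.1 (hM χ.not (Or.inl ⟨hχ.not, by simpa using hn⟩))) hr

/-- Elimination of a single existential quantifier suffices for quantifier elimination. -/
theorem exists_isQF_iff_of_ex
    (h : ∀ (n : ℕ) (M N : Theory.ModelType.{u, v, max u v} T) (x : α → M) (y : Fin n → M)
      (x' : α → N) (y' : Fin n → N),
      (∀ χ : L.BoundedFormula α n, χ.IsQF → χ.Realize x y → χ.Realize x' y') →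
      ∀ φ : L.BoundedFormula α (n + 1), φ.IsQF → ∀ b : M, φ.Realize x (Fin.snoc y b) →
        ∃ c : N, φ.Realize x' (Fin.snoc y' c))
    (φ : L.BoundedFormula α n) : ∃ ψ : L.BoundedFormula α n, ψ.IsQF ∧ T ⊨ᵇ φ.iff ψ := by
  induction φ using BoundedFormula.induction_on_exists_not with
  | hqf hψ => exact ⟨_, hψ, fun M x y => by simp⟩
  | hnot ih =>
    obtain ⟨ψ, hψ, hT⟩ := ih
    refine ⟨ψ.not, hψ.not, fun M x y => ?_⟩
    have := hT M x y
    simp only [BoundedFormula.realize_iff, BoundedFormula.realize_not] at this ⊢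
    rw [this]
  | @hex m φ ih =>
    obtain ⟨ψ, hψ, hT⟩ := ih
    have hT' : ∀ (M : Theory.ModelType.{u, v, max u v} T) (x : α → M) (y : Fin (m + 1) → M),
        φ.Realize x y ↔ ψ.Realize x y := fun M x y => BoundedFormula.realize_iff.1 (hT M x y)
    refine exists_isQF_iff _ fun M N x y x' y' hqf hφ => ?_
    rw [BoundedFormula.realize_ex] at hφ ⊢
    obtain ⟨b, hb⟩ := hφ
    obtain ⟨c, hc⟩ := h m M N x y x' y' hqf ψ hψ b ((hT' _ _ _).1 hb)
    exact ⟨c, (hT' _ _ _).2 hc⟩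
  -- The induction principle works up to equivalence modulo the empty theory, of which every model
  -- of T is a model.
  | @hse m φ₁ φ₂ h12 =>
    refine exists_congr fun ψ => and_congr_right fun _ => forall_congr' fun M =>
      forall_congr' fun x => forall_congr' fun y => ?_
    have := h12 (M.subtheoryModel (Set.empty_subset T)) x y
    have h3 : φ₁.Realize x y ↔ φ₂.Realize x y := BoundedFormula.realize_iff.1 this
    rw [BoundedFormula.realize_iff, BoundedFormula.realize_iff, h3]

end Criterion

/-! ### Ordered vector spaces and finite cuts. -/

namespace MultiOrder

variable {I C G : Type*} [Field C] [LinearOrder C] [AddCommGroup G] [Module C G]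
  (O : MultiOrder I C G) {i : I} {x y z : G}

theorem lt_irrefl' (i : I) (x : G) : ¬ O.lt i x x :=
  have := O.strictTotal i
  irrefl_of (O.lt i) x

theorem lt_trans' (h : O.lt i x y) (h' : O.lt i y z) : O.lt i x z :=
  have := O.strictTotal i
  trans_of (O.lt i) h h'

theorem lt_asymm' (h : O.lt i x y) : ¬ O.lt i y x :=
  fun h' => O.lt_irrefl' i x (O.lt_trans' h h')

theorem lt_or_lt_of_ne (i : I) (h : x ≠ y) : O.lt i x y ∨ O.lt i y x := by
  have := O.strictTotal i
  rcases trichotomous_of (O.lt i) x y with h' | h' | h'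
  · exact Or.inl h'
  · exact absurd h' h
  · exact Or.inr h'

theorem ne_of_lt' (h : O.lt i x y) : x ≠ y := by
  rintro rfl
  exact O.lt_irrefl' i x h

theorem add_lt_add_iff (i : I) (x y z : G) : O.lt i (x + z) (y + z) ↔ O.lt i x y := by
  refine ⟨fun h => ?_, O.add_lt_add i x y z⟩
  simpa using O.add_lt_add i _ _ (-z) h

theorem sub_pos' : O.lt i 0 (y - x) ↔ O.lt i x y := by
  rw [← O.add_lt_add_iff i 0 (y - x) x]
  simp

theorem sub_neg' : O.lt i (y - x) 0 ↔ O.lt i y x := by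
  rw [← O.add_lt_add_iff i (y - x) 0 x]
  simp

theorem neg_pos' : O.lt i 0 (-x) ↔ O.lt i x 0 := by
  rw [← O.add_lt_add_iff i 0 (-x) x]
  simp

theorem neg_neg' : O.lt i (-x) 0 ↔ O.lt i 0 x := by
  rw [← O.add_lt_add_iff i (-x) 0 x]
  simp

theorem smul_neg' {c : C} (hc : 0 < c) (hx : O.lt i x 0) : O.lt i (c • x) 0 := by
  rw [← O.neg_pos'] at hx ⊢
  simpa using O.smul_pos i c _ hc hx

/-- Finitely many compatible inequalities bound an interval. -/
theorem exists_interval (i : I) (A B : Finset G) (h : ∀ a ∈ A, ∀ b ∈ B, O.lt i a b) :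
    ∃ p q : WithBot (WithTop G), botTopLT (O.lt i) p q ∧ ∀ s ∈ interval (O.lt i) p q,
      (∀ a ∈ A, O.lt i a s) ∧ ∀ b ∈ B, O.lt i s b := by
  classical
  have := O.strictTotal i
  let _ : LinearOrder G := linearOrderOfSTO (O.lt i)
  change ∀ a ∈ A, ∀ b ∈ B, a < b at h
  -- With endpoints in `WithBot (WithTop G)`, empty A and B give `⊥` and `⊤`, so one-sided and
  -- absent bounds need no separate treatment.
  refine ⟨A.sup fun a => ((a : WithTop G) : WithBot (WithTop G)),
    B.inf fun a => ((a : WithTop G) : WithBot (WithTop G)), ?_, ?_⟩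
  · change (_ : WithBot (WithTop G)) < _
    have hb : (⊥ : WithBot (WithTop G)) < B.inf fun a => ((a : WithTop G) : WithBot (WithTop G)) :=
      (Finset.lt_inf_iff (WithBot.bot_lt_coe _)).2 fun b _ => WithBot.bot_lt_coe _
    rw [Finset.sup_lt_iff hb]
    intro a ha
    refine (Finset.lt_inf_iff (WithBot.coe_lt_coe.2 (WithTop.coe_lt_top _))).2 fun b hb => ?_
    exact WithBot.coe_lt_coe.2 (WithTop.coe_lt_coe.2 (h a ha b hb))
  · rintro s ⟨h1, h2⟩
    change (_ : WithBot (WithTop G)) < _ at h1 h2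
    refine ⟨fun a ha => ?_, fun b hb => ?_⟩
    · exact WithTop.coe_lt_coe.1 (WithBot.coe_lt_coe.1 ((Finset.le_sup ha).trans_lt h1))
    · exact WithTop.coe_lt_coe.1 (WithBot.coe_lt_coe.1 (h2.trans_le (Finset.inf_le hb)))

theorem IsIndependent.exists_between {O : MultiOrder I C G} [Fintype I] (hO : O.IsIndependent)
    (A B : I → Finset G) (h : ∀ i, ∀ a ∈ A i, ∀ b ∈ B i, O.lt i a b) :
    ∃ s, ∀ i, (∀ a ∈ A i, O.lt i a s) ∧ ∀ b ∈ B i, O.lt i s b := by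
  choose p q hpq hs using fun i => O.exists_interval i (A i) (B i) (h i)
  obtain ⟨s, hs'⟩ := hO Finset.univ p q fun i _ => hpq i
  simp only [Set.mem_iInter] at hs'
  exact ⟨s, fun i => hs i s (hs' i (Finset.mem_univ i))⟩

end MultiOrder

/-- A rank-one map that vanishes on U but not at b corrects g at b. Since all maps live on the whole
of G, no domains of partial maps have to be tracked. -/
theorem exists_linearMap_eq_and_apply_eq {C G G' : Type*} [Field C] [AddCommGroup G] [Module C G]
    [AddCommGroup G'] [Module C G'] {U : Submodule C G} {b : G} (hb : b ∉ U)
    (g : G →ₗ[C] G') (b' : G') :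
    ∃ g' : G →ₗ[C] G', (∀ u ∈ U, g' u = g u) ∧ g' b = b' := by
  obtain ⟨φ, hφ, hφU⟩ := U.exists_le_ker_of_notMem hb
  refine ⟨g + φ.smulRight ((φ b)⁻¹ • (b' - g b)), fun u hu => ?_, ?_⟩
  · have : φ u = 0 := hφU hu
    simp [this]
  · simp [smul_smul, hφ]

namespace HamelSpace

/-! ### Valuation theory of a Hamel space. -/

section Valuation

variable {C G : Type*} [Field C] [LinearOrder C] [AddCommGroup G] [Module C G]
  {H : HamelSpace C G}

/-- The linear order `<₀` on `G`. -/
noncomputable abbrev order (H : HamelSpace C G) : LinearOrder G :=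
  have := H.strictTotal 0
  open Classical in linearOrderOfSTO (H.lt 0)

variable {x y z γ : G}

theorem v_zero (H : HamelSpace C G) : H.v 0 = ⊤ := (H.v_eq_top 0).2 rfl

theorem v_neg (H : HamelSpace C G) (x : G) : H.v (-x) = H.v x := by
  simpa using H.v_smul (-1) x (by simp)

theorem v_sub_comm (H : HamelSpace C G) (x y : G) : H.v (x - y) = H.v (y - x) := by
  rw [← neg_sub, v_neg]

theorem exists_v_eq (H : HamelSpace C G) (hx : x ≠ 0) : ∃ γ : G, H.v x = γ := by
  have : H.v x ≠ ⊤ := fun h => hx ((H.v_eq_top x).1 h)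
  exact ⟨_, (WithTop.coe_untop _ this).symm⟩

theorem v_of_v_eq (h : H.v x = γ) : H.v γ = γ := by
  have := H.v_idem x
  rw [h] at this
  exact this

theorem pos_of_v_eq (h : H.v x = γ) : H.lt 1 0 γ := by
  have := H.v_pos x
  rw [h] at this
  exact (topLT_coe _ _ _).1 this

variable [LinearOrder G]

theorem topLT_iff (h0 : H.lt 0 = (· < ·)) {a b : WithTop G} : topLT (H.lt 0) a b ↔ a < b := by
  rw [h0]
  rfl

theorem topLE_iff (h0 : H.lt 0 = (· < ·)) {a b : WithTop G} : topLE (H.lt 0) a b ↔ a ≤ b := by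
  rw [topLE, topLT_iff h0, le_iff_lt_or_eq]

theorem min_le_v_add (h0 : H.lt 0 = (· < ·)) (x y : G) : min (H.v x) (H.v y) ≤ H.v (x + y) := by
  have := H.v_add x y
  rw [topLE_iff h0, topLE_iff h0] at this
  exact min_le_iff.2 this

theorem min_le_v_sub (h0 : H.lt 0 = (· < ·)) (x y : G) : min (H.v x) (H.v y) ≤ H.v (x - y) := by
  have := min_le_v_add h0 x (-y)
  rwa [v_neg, ← sub_eq_add_neg] at this

theorem v_add_eq_left (h0 : H.lt 0 = (· < ·)) (h : H.v x < H.v y) : H.v (x + y) = H.v x := by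
  refine le_antisymm ?_ ((min_eq_left h.le).symm.trans_le (min_le_v_add h0 x y))
  have := min_le_v_sub h0 (x + y) y
  rw [add_sub_cancel_right] at this
  rcases min_le_iff.1 this with h' | h'
  · exact h'
  · exact absurd h' h.not_ge

theorem v_sub_eq_left (h0 : H.lt 0 = (· < ·)) (h : H.v x < H.v y) : H.v (x - y) = H.v x := by
  rw [sub_eq_add_neg]
  exact v_add_eq_left h0 (by rwa [v_neg])

theorem v_le_of_lt (h0 : H.lt 0 = (· < ·)) (hx : H.lt 1 0 x) (h : H.lt 1 x y) : H.v y ≤ H.v x :=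
  (topLE_iff h0).1 (H.v_convex x y hx h)

/-- Otherwise `0 <₁ x <₁ -y`, and convexity gives `v y ≤ v x`. Thus the term of smaller value
decides the sign for `<₁`. -/
theorem pos_add_of_v_lt (h0 : H.lt 0 = (· < ·)) (h : H.v x < H.v y)
    (hx : H.lt 1 0 x) : H.lt 1 0 (x + y) := by
  have hne : x + y ≠ 0 := by
    intro h'
    rw [eq_neg_of_add_eq_zero_left h', v_neg] at h
    exact lt_irrefl _ h
  refine (H.lt_or_lt_of_ne 1 hne.symm).resolve_right fun h' => ?_
  have : H.lt 1 x (-y) := by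
    rw [← H.sub_neg']
    simpa using h'
  have := v_le_of_lt h0 hx this
  rw [v_neg] at this
  exact this.not_gt h

theorem neg_add_of_v_lt (h0 : H.lt 0 = (· < ·)) (h : H.v x < H.v y)
    (hx : H.lt 1 x 0) : H.lt 1 (x + y) 0 := by
  rw [← H.neg_pos'] at hx ⊢
  rw [neg_add]
  exact pos_add_of_v_lt h0 (by rwa [v_neg, v_neg]) hx

/-- A point `<₁`-between two points at the same distance from `w` on the same side has that
distance from `w`. -/
theorem v_sub_of_between (h0 : H.lt 0 = (· < ·)) {s t w : G}
    (hs : H.v (s - w) = γ) (ht : H.v (t - w) = γ)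
    (hst : H.lt 1 w s ∨ H.lt 1 t w) (hsy : H.lt 1 s y) (hyt : H.lt 1 y t) :
    H.v (y - w) = γ := by
  rcases hst with h | h
  · refine le_antisymm ?_ ?_
    · rw [← hs]
      refine v_le_of_lt h0 (H.sub_pos'.2 h) ?_
      rw [← H.sub_pos', sub_sub_sub_cancel_right, H.sub_pos']
      exact hsy
    · rw [← ht]
      refine v_le_of_lt h0 (H.sub_pos'.2 (H.lt_trans' h hsy)) ?_
      rw [← H.sub_pos', sub_sub_sub_cancel_right, H.sub_pos']
      exact hyt
  · rw [v_sub_comm] at hs ht ⊢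
    refine le_antisymm ?_ ?_
    · rw [← ht]
      refine v_le_of_lt h0 (H.sub_pos'.2 h) ?_
      rw [← H.sub_pos', sub_sub_sub_cancel_left, H.sub_pos']
      exact hyt
    · rw [← hs]
      refine v_le_of_lt h0 (H.sub_pos'.2 (H.lt_trans' hyt h)) ?_
      rw [← H.sub_pos', sub_sub_sub_cancel_left, H.sub_pos']
      exact hsy

end Valuation

/-! ### Finite approximations to embeddings. -/

section Approximation

variable {C G G' : Type*} [Field C] [LinearOrder C] [AddCommGroup G] [Module C G]
  [AddCommGroup G'] [Module C G'] {H : HamelSpace C G} {K : HamelSpace C G'}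
  {g g' : G →ₗ[C] G'} {x y : G}

/-- The linear map `g` preserves the signs and the value of `x`. -/
structure Preserves (H : HamelSpace C G) (K : HamelSpace C G') (g : G →ₗ[C] G') (x : G) :
    Prop where
  pos : ∀ i, H.lt i 0 x → K.lt i 0 (g x)
  neg : ∀ i, H.lt i x 0 → K.lt i (g x) 0
  map_v : K.v (g x) = (H.v x).map g

theorem Preserves.lt (h : H.Preserves K g (y - x)) {i : Fin 2} (hxy : H.lt i x y) :
    K.lt i (g x) (g y) := by
  have := h.pos i (H.sub_pos'.2 hxy)
  rwa [map_sub, K.sub_pos'] at this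

/-- Only 0 has value `∞`, so preservation of the value of `y - x` already prevents g from
identifying x with y. -/
theorem Preserves.eq_iff (h : H.Preserves K g (y - x)) : g x = g y ↔ x = y := by
  refine ⟨fun h' => ?_, congrArg g⟩
  have := h.map_v
  rw [map_sub, h', sub_self, v_zero, eq_comm, WithTop.map_eq_top_iff, H.v_eq_top,
    sub_eq_zero] at this
  exact this.symm

theorem Preserves.lt_iff (h : H.Preserves K g (y - x)) {i : Fin 2} :
    K.lt i (g x) (g y) ↔ H.lt i x y := by
  refine ⟨fun h' => ?_, h.lt⟩
  by_contra hn
  rcases eq_or_ne x y with rfl | hne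
  · exact K.lt_irrefl' _ _ h'
  · have := h.neg i (H.sub_neg'.2 ((H.lt_or_lt_of_ne i hne).resolve_left hn))
    rw [map_sub, K.sub_neg'] at this
    exact K.lt_asymm' this h'

theorem Preserves.smul [IsStrictOrderedRing C] (h : H.Preserves K g x) {c : C} (hc : c ≠ 0) :
    H.Preserves K g (c • x) := by
  rcases eq_or_ne x 0 with rfl | hx
  · simpa using h
  have hv : K.v (g (c • x)) = (H.v (c • x)).map g := by
    rw [map_smul, K.v_smul c _ hc, H.v_smul c _ hc, h.map_v]
  have key : ∀ (c : C) (_ : 0 < c) (x : G) (_ : x ≠ 0), (∀ i, H.lt i 0 x → K.lt i 0 (g x)) →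
      (∀ i, H.lt i x 0 → K.lt i (g x) 0) → (∀ i, H.lt i 0 (c • x) → K.lt i 0 (g (c • x))) ∧
      (∀ i, H.lt i (c • x) 0 → K.lt i (g (c • x)) 0) := by
    intro c hc x hx h1 h2
    refine ⟨fun i hi => ?_, fun i hi => ?_⟩
    · rw [map_smul]
      refine K.smul_pos i c _ hc (h1 i ((H.lt_or_lt_of_ne i hx.symm).resolve_right fun h' => ?_))
      exact H.lt_asymm' hi (H.smul_neg' hc h')
    · rw [map_smul]
      refine K.smul_neg' hc (h2 i ((H.lt_or_lt_of_ne i hx).resolve_right fun h' => ?_))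
      exact H.lt_asymm' hi (H.smul_pos i c _ hc h')
  rcases lt_or_gt_of_ne hc with hc' | hc'
  · obtain ⟨h1, h2⟩ := key (-c) (neg_pos.2 hc') (-x) (neg_ne_zero.2 hx)
      (fun i hi => by rw [map_neg, K.neg_pos']; exact h.neg i (H.neg_pos'.1 hi))
      (fun i hi => by rw [map_neg, K.neg_neg']; exact h.pos i (H.neg_neg'.1 hi))
    rw [neg_smul_neg] at h1 h2
    exact ⟨h1, h2, hv⟩
  · obtain ⟨h1, h2⟩ := key c hc' x hx h.pos h.neg
    exact ⟨h1, h2, hv⟩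

/-- The subspace `U` is closed under the valuation. -/
def VClosed (H : HamelSpace C G) (U : Submodule C G) : Prop :=
  ∀ x ∈ U, ∀ γ : G, H.v x = γ → γ ∈ U

/-- Preservation of the value evaluates the map at `v x` as well as at x, which is why U must be
closed under the valuation. -/
theorem Preserves.congr {U : Submodule C G} (hU : H.VClosed U) (h : H.Preserves K g x)
    (hg : ∀ u ∈ U, g' u = g u) (hx : x ∈ U) : H.Preserves K g' x := by
  refine ⟨?_, ?_, ?_⟩
  · rw [hg x hx]
    exact h.pos
  · rw [hg x hx]
    exact h.neg
  · rw [hg x hx, h.map_v]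
    cases hv : H.v x with
    | top => rfl
    | coe γ => rw [WithTop.map_coe, WithTop.map_coe, hg γ (hU x hx γ hv)]

/-- The linear map `f` on `A` can be extended to linear maps that preserve any given finite part of
the structure of `U`. -/
def Approx (H : HamelSpace C G) (K : HamelSpace C G') (A : Submodule C G) (f : G →ₗ[C] G')
    (U : Submodule C G) : Prop :=
  ∃ l : Filter (G →ₗ[C] G'), l.NeBot ∧ (∀ᶠ g in l, ∀ x ∈ A, g x = f x) ∧
    ∀ x ∈ U, ∀ᶠ g in l, H.Preserves K g x

variable {A U : Submodule C G} {f : G →ₗ[C] G'}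

/-- The filter is the image of `atTop` on the finite subsets of U under a choice of one good map for
each subset. Together with `Approx.exists_of_finite` this says that approximability has finite
character. -/
theorem approx_of_finite
    (h : ∀ E : Finset G, (E : Set G) ⊆ U → ∃ g : G →ₗ[C] G', (∀ x ∈ A, g x = f x) ∧
      ∀ x ∈ E, H.Preserves K g x) : H.Approx K A f U := by
  classical
  choose! g hg hg' using h
  let e : Finset U → Finset G := fun s => s.map (Function.Embedding.subtype _)
  have he : ∀ s, (e s : Set G) ⊆ U := fun s x hx => by
    obtain ⟨y, -, rfl⟩ := Finset.mem_map.1 hx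
    exact y.2
  refine ⟨Filter.map (fun s => g (e s)) Filter.atTop, inferInstance, ?_, ?_⟩
  · exact Filter.eventually_map.2 (Filter.Eventually.of_forall fun s => hg _ (he s))
  · intro x hx
    refine Filter.eventually_map.2 (Filter.eventually_atTop.2 ⟨{⟨x, hx⟩}, fun s hs => ?_⟩)
    refine hg' _ (he s) x ?_
    simpa [e, hx] using hs

theorem Approx.exists_of_finite (h : H.Approx K A f U) (E : Finset G) (hE : (E : Set G) ⊆ U) :
    ∃ g : G →ₗ[C] G', (∀ x ∈ A, g x = f x) ∧ ∀ x ∈ E, H.Preserves K g x := by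
  obtain ⟨l, hl, hA, hU⟩ := h
  exact (hA.and ((Filter.eventually_all_finset E).2 fun x hx => hU x (hE hx))).exists

/-- Extension of approximations by one element. -/
theorem Approx.sup_span_singleton [IsStrictOrderedRing C] (h : H.Approx K A f U) (hAU : A ≤ U)
    (hU : H.VClosed U) {b : G} (hb : b ∉ U)
    (key : ∀ l : Filter (G →ₗ[C] G'), (∀ x ∈ U, ∀ᶠ g in l, H.Preserves K g x) →
      ∀ W : Finset G, (W : Set G) ⊆ U → ∀ᶠ g in l, ∃ b' : G', ∀ g' : G →ₗ[C] G',
        (∀ u ∈ U, g' u = g u) → g' b = b' → ∀ w ∈ W, H.Preserves K g' (b - w)) :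
    H.Approx K A f (U ⊔ Submodule.span C {b}) := by
  classical
  refine approx_of_finite fun E hE => ?_
  have hE' : ∀ e ∈ E, ∃ u ∈ U, ∃ c : C, e = u + c • b := fun e he => by
    obtain ⟨u, hu, y, hy, rfl⟩ := Submodule.mem_sup.1 (hE he)
    obtain ⟨c, rfl⟩ := Submodule.mem_span_singleton.1 hy
    exact ⟨u, hu, c, rfl⟩
  choose! p hpU c hpc using hE'
  obtain ⟨l, hl, hlA, hlU⟩ := h
  have h1 : ∀ᶠ g in l, ∀ e ∈ E, H.Preserves K g (p e) :=
    (Filter.eventually_all_finset E).2 fun e he => hlU _ (hpU e he)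
  -- A vector `p + c • b` with `c ≠ 0` equals `c • (b - w)` for `w = -(c⁻¹ • p)`, and preservation
  -- is stable under nonzero scalars. So only differences `b - w` with w in U need attention.
  obtain ⟨g, hgA, hgE, b', hb'⟩ := (hlA.and (h1.and (key l hlU
    (E.image fun e => -((c e)⁻¹ • p e)) (by
      intro w hw
      obtain ⟨e, he, rfl⟩ := Finset.mem_image.1 hw
      exact U.neg_mem (U.smul_mem _ (hpU e he)))))).exists
  obtain ⟨g', hg'U, hg'b⟩ := exists_linearMap_eq_and_apply_eq hb g b'
  refine ⟨g', fun x hx => (hg'U x (hAU hx)).trans (hgA x hx), fun e he => ?_⟩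
  by_cases hc : c e = 0
  · have : e = p e := by simpa [hc] using hpc e he
    rw [this]
    exact (hgE e he).congr hU hg'U (hpU e he)
  · have : e = c e • (b - -((c e)⁻¹ • p e)) := by
      rw [sub_neg_eq_add, smul_add, smul_smul, mul_inv_cancel₀ hc, one_smul, add_comm]
      exact hpc e he
    rw [this]
    exact (hb' g' hg'U hg'b _ (Finset.mem_image_of_mem _ he)).smul hc

end Approximation

end HamelSpace

namespace MultiOrder

variable {I C G : Type*} [Field C] [LinearOrder C] [AddCommGroup G] [Module C G]
  (O : MultiOrder I C G)

theorem exists_max (i : I) {A : Finset G} (hA : A.Nonempty) :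
    ∃ p ∈ A, ∀ a ∈ A, a = p ∨ O.lt i a p := by
  classical
  have := O.strictTotal i
  let _ : LinearOrder G := linearOrderOfSTO (O.lt i)
  obtain ⟨p, hp, h⟩ := A.exists_max_image id hA
  exact ⟨p, hp, fun a ha => (h a ha).eq_or_lt⟩

theorem exists_min (i : I) {A : Finset G} (hA : A.Nonempty) :
    ∃ p ∈ A, ∀ a ∈ A, a = p ∨ O.lt i p a := by
  classical
  have := O.strictTotal i
  let _ : LinearOrder G := linearOrderOfSTO (O.lt i)
  obtain ⟨p, hp, h⟩ := A.exists_min_image id hA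
  exact ⟨p, hp, fun a ha => (h a ha).eq_or_lt.imp_left Eq.symm⟩

end MultiOrder

namespace HamelSpace

variable {C G G' : Type*} [Field C] [LinearOrder C] [AddCommGroup G] [Module C G]
  [AddCommGroup G'] [Module C G'] {H : HamelSpace C G} {K : HamelSpace C G'}
  {U : Submodule C G} {b γ : G}

/-! ### Adjoining a value. -/

section Value

/-- Independence, used with no condition on `<₁`, gives `s <₀ t` inside the cut. Density then puts a
value between them, and this value is finite because it lies below t. -/
theorem exists_value_between (hi : K.IsIndependent) (hd : K.IsDense) (A B : Finset G')
    (h : ∀ a ∈ A, ∀ b ∈ B, K.lt 0 a b) :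
    ∃ β : G', K.v β = β ∧ (∀ a ∈ A, K.lt 0 a β) ∧ ∀ b ∈ B, K.lt 0 β b := by
  classical
  have key : ∀ A : Finset G', (∀ a ∈ A, ∀ b ∈ B, K.lt 0 a b) →
      ∃ s, (∀ a ∈ A, K.lt 0 a s) ∧ ∀ b ∈ B, K.lt 0 s b := by
    intro A h
    obtain ⟨s, hs⟩ := MultiOrder.IsIndependent.exists_between hi
      (fun i => if i = 0 then A else ∅) (fun i => if i = 0 then B else ∅) (by
        intro i
        by_cases hi : i = 0
        · subst hi
          simpa using h
        · simp [hi])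
    exact ⟨s, by simpa using hs 0⟩
  obtain ⟨s, hsA, hsB⟩ := key A h
  obtain ⟨t, htA, htB⟩ := key {s} (by simpa using hsB)
  obtain ⟨c, hsc, hct⟩ := hd s t (htA s (by simp))
  obtain ⟨β, hβ⟩ : ∃ β : G', K.v c = β := by
    cases hc : K.v c with
    | top =>
      rw [hc] at hct
      exact absurd hct (not_top_topLT _ _)
    | coe β => exact ⟨β, rfl⟩
  rw [hβ, topLT_coe] at hsc hct
  exact ⟨β, v_of_v_eq hβ, fun a ha => K.lt_trans' (hsA a ha) hsc,
    fun b hb => K.lt_trans' hct (htB b hb)⟩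

/-- An element u of U cannot have value γ, since γ would then lie in U. So for `c ≠ 0` the value of
`u + c • γ` is the smaller of `v u` and γ, and no further new value appears. -/
theorem VClosed.sup_span_singleton [LinearOrder G] (h0 : H.lt 0 = (· < ·)) (hU : H.VClosed U)
    (hγ : H.v γ = γ) (hγU : γ ∉ U) : H.VClosed (U ⊔ Submodule.span C {γ}) := by
  intro x hx δ hδ
  obtain ⟨u, hu, y, hy, rfl⟩ := Submodule.mem_sup.1 hx
  obtain ⟨c, rfl⟩ := Submodule.mem_span_singleton.1 hy
  have hγ' : γ ∈ U ⊔ Submodule.span C {γ} :=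
    Submodule.mem_sup_right (Submodule.mem_span_singleton_self γ)
  by_cases hc : c = 0
  · rw [hc, zero_smul, add_zero] at hδ
    exact Submodule.mem_sup_left (hU u hu δ hδ)
  · have hv : H.v (c • γ) = γ := by rw [H.v_smul c γ hc, hγ]
    rcases lt_trichotomy (H.v u) (H.v (c • γ)) with h | h | h
    · rw [v_add_eq_left h0 h] at hδ
      exact Submodule.mem_sup_left (hU u hu δ hδ)
    · exact absurd (hU u hu γ (h.trans hv)) hγU
    · rw [add_comm, v_add_eq_left h0 h, hv] at hδ
      rwa [← WithTop.coe_inj.1 hδ]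

/-- Since `v w ≠ γ`, there are two cases. If `v w <₀ γ`, then `γ - w` has the value of w and the
`<₁`-sign of `-w`. If `γ <₀ v w`, it has value γ and is positive, because values are positive for
`<₁`. Hence it is enough that β is a value in the same `<₀`-position relative to the images of w and
`v w`. -/
theorem preserves_value_sub [LinearOrder G] [LinearOrder G'] (h0 : H.lt 0 = (· < ·))
    (k0 : K.lt 0 = (· < ·)) (hU : H.VClosed U) (hγ : H.v γ = γ) (hγU : γ ∉ U)
    {g : G →ₗ[C] G'} {w : G} (hw : w ∈ U) (hgw : H.Preserves K g w) {β : G'} (hβ : K.v β = β)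
    (hl : ∀ x, x = w ∨ H.v w = x → x < γ → g x < β)
    (hr : ∀ x, x = w ∨ H.v w = x → γ < x → β < g x) {g' : G →ₗ[C] G'}
    (hg : ∀ u ∈ U, g' u = g u) (hgγ : g' γ = β) : H.Preserves K g' (γ - w) := by
  have hne : γ ≠ w := fun h => hγU (h ▸ hw)
  have e : g' (γ - w) = β - g w := by rw [map_sub, hgγ, hg w hw]
  have hlt0 : (H.lt 0 0 (γ - w) → K.lt 0 0 (g' (γ - w))) ∧
      (H.lt 0 (γ - w) 0 → K.lt 0 (g' (γ - w)) 0) := by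
    rw [e, H.sub_pos', K.sub_pos', H.sub_neg', K.sub_neg', h0, k0]
    exact ⟨hl w (Or.inl rfl), hr w (Or.inl rfl)⟩
  suffices h : (H.lt 1 0 (γ - w) → K.lt 1 0 (g' (γ - w))) ∧
      (H.lt 1 (γ - w) 0 → K.lt 1 (g' (γ - w)) 0) ∧ K.v (g' (γ - w)) = (H.v (γ - w)).map g' by
    refine ⟨fun i => ?_, fun i => ?_, h.2.2⟩
    · fin_cases i
      exacts [hlt0.1, h.1]
    · fin_cases i
      exacts [hlt0.2, h.2.1]
  rw [e]
  rcases lt_trichotomy (H.v w) (H.v γ) with h | h | h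
  · obtain ⟨δ, hδ⟩ : ∃ δ : G, H.v w = δ := ⟨_, (WithTop.coe_untop _ h.ne_top).symm⟩
    have hδγ : δ < γ := by rwa [hδ, hγ, WithTop.coe_lt_coe] at h
    have hgδ : K.v (g w) = g δ := by rw [hgw.map_v, hδ, WithTop.map_coe]
    have hK : K.v (g w) < K.v β := by
      rw [hgδ, hβ, WithTop.coe_lt_coe]
      exact hl δ (Or.inr hδ) hδγ
    have hw0 : w ≠ 0 := by
      rintro rfl
      rw [v_zero] at hδ
      exact WithTop.top_ne_coe hδ
    refine ⟨fun hp => ?_, fun hn => ?_, ?_⟩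
    · rcases H.lt_or_lt_of_ne 1 hw0 with h' | h'
      · have := pos_add_of_v_lt k0 (x := -g w) (y := β) (by rwa [v_neg])
          (K.neg_pos'.2 (hgw.neg 1 h'))
        rwa [neg_add_eq_sub] at this
      · have := neg_add_of_v_lt h0 (x := -w) (y := γ) (by rwa [v_neg]) (H.neg_neg'.2 h')
        rw [neg_add_eq_sub] at this
        exact absurd hp (H.lt_asymm' this)
    · rcases H.lt_or_lt_of_ne 1 hw0 with h' | h'
      · have := pos_add_of_v_lt h0 (x := -w) (y := γ) (by rwa [v_neg]) (H.neg_pos'.2 h')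
        rw [neg_add_eq_sub] at this
        exact absurd hn (H.lt_asymm' this)
      · have := neg_add_of_v_lt k0 (x := -g w) (y := β) (by rwa [v_neg])
          (K.neg_neg'.2 (hgw.pos 1 h'))
        rwa [neg_add_eq_sub] at this
    · rw [v_sub_comm, v_sub_eq_left k0 hK, v_sub_comm, v_sub_eq_left h0 h, hgδ, hδ,
        WithTop.map_coe, hg δ (hU w hw δ hδ)]
  · exact absurd (hU w hw γ (h.trans hγ)) hγU
  · have hK : K.v β < K.v (g w) := by
      rw [hgw.map_v, hβ]
      cases hδ : H.v w with
      | top => exact WithTop.coe_lt_top _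
      | coe δ =>
        rw [hδ, hγ, WithTop.coe_lt_coe] at h
        rw [WithTop.map_coe, WithTop.coe_lt_coe]
        exact hr δ (Or.inr hδ) h
    have hp : H.lt 1 0 (γ - w) := by
      have := pos_add_of_v_lt h0 (x := γ) (y := -w) (by rwa [v_neg]) (pos_of_v_eq hγ)
      rwa [← sub_eq_add_neg] at this
    refine ⟨fun _ => ?_, fun hn => absurd hn (H.lt_asymm' hp), ?_⟩
    · have := pos_add_of_v_lt k0 (x := β) (y := -g w) (by rwa [v_neg]) (pos_of_v_eq hβ)
      rwa [← sub_eq_add_neg] at this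
    · rw [v_sub_eq_left k0 hK, v_sub_eq_left h0 h, hγ, hβ, WithTop.map_coe, hgγ]

theorem Approx.sup_span_value [IsStrictOrderedRing C] (hi : K.IsIndependent) (hd : K.IsDense)
    {A : Submodule C G} {f : G →ₗ[C] G'} (h : H.Approx K A f U) (hAU : A ≤ U)
    (hU : H.VClosed U) (hγ : H.v γ = γ) (hγU : γ ∉ U) :
    H.Approx K A f (U ⊔ Submodule.span C {γ}) := by
  classical
  let _ := H.order
  let _ := K.order
  refine h.sup_span_singleton hAU hU hγU fun l hl W hW => ?_
  -- The cut of γ must be matched relative to the values of points of W too. If 0 lies in W, its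
  -- value `∞` is replaced by the harmless vector 0.
  let X : Finset G := W ∪ W.image fun w => (H.v w).untopD 0
  have hX : ∀ x ∈ X, x ∈ U := by
    intro x hx
    rcases Finset.mem_union.1 hx with hx | hx
    · exact hW hx
    · obtain ⟨w, hw, rfl⟩ := Finset.mem_image.1 hx
      cases hv : H.v w with
      | top => exact U.zero_mem
      | coe δ => exact hU w (hW hw) δ hv
  have hXmem : ∀ w ∈ W, ∀ x, x = w ∨ H.v w = x → x ∈ X := by
    rintro w hw x (rfl | hx)
    · exact Finset.mem_union_left _ hw
    · refine Finset.mem_union_right _ (Finset.mem_image.2 ⟨w, hw, ?_⟩)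
      rw [hx]
      rfl
  have h1 : ∀ᶠ g in l, ∀ x ∈ X, ∀ y ∈ X, H.Preserves K g (y - x) :=
    (Filter.eventually_all_finset X).2 fun x hx => (Filter.eventually_all_finset X).2
      fun y hy => hl _ (U.sub_mem (hX y hy) (hX x hx))
  have h2 : ∀ᶠ g in l, ∀ w ∈ W, H.Preserves K g w :=
    (Filter.eventually_all_finset W).2 fun w hw => hl _ (hW hw)
  filter_upwards [h1, h2] with g hg1 hg2
  obtain ⟨β, hβ, hβl, hβr⟩ := exists_value_between hi hd ((X.filter (· < γ)).image g)
    ((X.filter (γ < ·)).image g) (by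
      intro a ha b hb
      obtain ⟨x, hx, rfl⟩ := Finset.mem_image.1 ha
      obtain ⟨y, hy, rfl⟩ := Finset.mem_image.1 hb
      obtain ⟨hx, hxγ⟩ := Finset.mem_filter.1 hx
      obtain ⟨hy, hyγ⟩ := Finset.mem_filter.1 hy
      exact (hg1 x hx y hy).lt (hxγ.trans hyγ))
  refine ⟨β, fun g' hg' hgγ w hw => preserves_value_sub rfl rfl hU hγ hγU (hW hw) (hg2 w hw) hβ
    (fun x hx hxγ => ?_) (fun x hx hxγ => ?_) hg' hgγ⟩
  · exact hβl _ (Finset.mem_image_of_mem _ (Finset.mem_filter.2 ⟨hXmem w hw x hx, hxγ⟩))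
  · exact hβr _ (Finset.mem_image_of_mem _ (Finset.mem_filter.2 ⟨hXmem w hw x hx, hxγ⟩))

end Value


/-! ### Adjoining a vector once all values are present. -/

/-- The point `s` lies in the same position as `b` relative to the points of `W`, with the same
distances. -/
def Fits (H : HamelSpace C G) (W : Finset G) (b s : G) : Prop :=
  ∀ w ∈ W, (H.lt 1 w b → H.lt 1 w s) ∧ (H.lt 1 b w → H.lt 1 s w) ∧ H.v (s - w) = H.v (b - w)

variable {W : Finset G} {s : G}

/-- From `0 <₁ δ ≤₁ p + δ - w` convexity bounds the value of `p + δ - w` above by r, and the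
ultrametric inequality bounds it below by r. -/
theorem lt_add_and_v_eq [LinearOrder G] (h0 : H.lt 0 = (· < ·)) {w p δ : G} {r : WithTop G}
    (hwp : w = p ∨ H.lt 1 w p) (hδ : H.lt 1 0 δ) (hvδ : H.v δ = r) (hv : r ≤ H.v (p - w)) :
    H.lt 1 w (p + δ) ∧ H.v (p + δ - w) = r := by
  have e : p + δ - w = (p - w) + δ := by abel
  rw [← H.sub_pos', e]
  rcases hwp with rfl | h
  · rw [sub_self, zero_add]
    exact ⟨hδ, hvδ⟩
  · have hp := H.sub_pos'.2 h
    have h1 : H.lt 1 δ (p - w + δ) := by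
      rw [← H.sub_pos', add_sub_cancel_right]
      exact hp
    refine ⟨H.lt_trans' hδ h1, le_antisymm ((v_le_of_lt h0 hδ h1).trans_eq hvδ) ?_⟩
    refine le_trans ?_ (min_le_v_add h0 _ _)
    rw [hvδ]
    exact le_min hv le_rfl

theorem sub_lt_and_v_eq [LinearOrder G] (h0 : H.lt 0 = (· < ·)) {w q δ : G} {r : WithTop G}
    (hwq : w = q ∨ H.lt 1 q w) (hδ : H.lt 1 0 δ) (hvδ : H.v δ = r) (hv : r ≤ H.v (q - w)) :
    H.lt 1 (q - δ) w ∧ H.v (q - δ - w) = r := by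
  have e : q - δ - w = -(-q + δ - -w) := by abel
  have := lt_add_and_v_eq h0 (w := -w) (p := -q) (δ := δ) (r := r)
    (hwq.imp (fun h => by rw [h]) fun h => by
      rw [← H.sub_pos'] at h ⊢
      rwa [neg_sub_neg]) hδ hvδ (by rwa [neg_sub_neg, v_sub_comm])
  rw [e, v_neg]
  refine ⟨?_, this.2⟩
  have h1 := this.1
  rw [← H.sub_pos'] at h1 ⊢
  convert h1 using 1
  abel

/-- Here r is an upper bound for the distances `v (b - w)`, and s is at distance at least r from b.
Points with `v (b - w)` below r cannot tell s from b, because `b - w` dominates `s - b`. For the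
remaining, nearest points, s must be reached by a step of value exactly r, upward from some p that
bounds those left of b or downward from some q that bounds those right of b. -/
theorem fits_of_max [LinearOrder G] (h0 : H.lt 0 = (· < ·)) (r : WithTop G)
    (hmax : ∀ w ∈ W, H.v (b - w) ≤ r) (hs : r ≤ H.v (s - b)) (hbW : b ∉ W)
    (hl : ∀ w ∈ W, H.v (b - w) = r → H.lt 1 w b → ∃ p δ, (w = p ∨ H.lt 1 w p) ∧
      r ≤ H.v (b - p) ∧ H.lt 1 0 δ ∧ H.v δ = r ∧ s = p + δ)
    (hr : ∀ w ∈ W, H.v (b - w) = r → H.lt 1 b w → ∃ q δ, (w = q ∨ H.lt 1 q w) ∧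
      r ≤ H.v (b - q) ∧ H.lt 1 0 δ ∧ H.v δ = r ∧ s = q - δ) : H.Fits W b s := by
  intro w hw
  rcases (hmax w hw).lt_or_eq with h | h
  · have h1 : H.v (b - w) < H.v (s - b) := h.trans_le hs
    have e : b - w + (s - b) = s - w := by abel
    refine ⟨fun h' => ?_, fun h' => ?_, ?_⟩
    · have := pos_add_of_v_lt h0 h1 (H.sub_pos'.2 h')
      rwa [e, H.sub_pos'] at this
    · have := neg_add_of_v_lt h0 h1 (H.sub_neg'.2 h')
      rwa [e, H.sub_neg'] at this
    · rw [← e, v_add_eq_left h0 h1]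
  · have key : ∀ p, r ≤ H.v (b - p) → r ≤ H.v (p - w) := by
      intro p hp
      have := min_le_v_sub h0 (b - w) (b - p)
      rw [sub_sub_sub_cancel_left] at this
      exact (le_min h.ge hp).trans this
    rcases H.lt_or_lt_of_ne 1 (x := w) (y := b) (fun e => hbW (e ▸ hw)) with h' | h'
    · obtain ⟨p, δ, hwp, hp, hδ, hvδ, rfl⟩ := hl w hw h h'
      obtain ⟨h1, h2⟩ := lt_add_and_v_eq h0 hwp hδ hvδ (key p hp)
      exact ⟨fun _ => h1, fun h'' => absurd h'' (H.lt_asymm' h'), h2.trans h.symm⟩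
    · obtain ⟨p, δ, hwp, hp, hδ, hvδ, rfl⟩ := hr w hw h h'
      obtain ⟨h1, h2⟩ := sub_lt_and_v_eq h0 hwp hδ hvδ (key p hp)
      exact ⟨fun h'' => absurd h'' (H.lt_asymm' h'), fun _ => h1, h2.trans h.symm⟩

/-- Let γ be the largest value `v (b - w)`. It lies in U and serves as a step of the right size. If
nearest points occur on only one side of b, move away from the outermost of them, toward the side of
b, by one and two steps. If they occur on both sides, with p and q the innermost ones, then `v (q -
p) = γ` and the points at one and two thirds of the way from p to q work. The vector b itself need
not lie between s and t. -/
theorem exists_fits [IsStrictOrderedRing C] (hU : ∀ x γ : G, H.v x = γ → γ ∈ U) (hbU : b ∉ U)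
    (hWU : (W : Set G) ⊆ U) :
    ∃ s ∈ U, ∃ t ∈ U, H.lt 1 s t ∧ H.Fits W b s ∧ H.Fits W b t := by
  classical
  let _ := H.order
  have h0 : H.lt 0 = (· < ·) := rfl
  have hbW : b ∉ W := fun h => hbU (hWU h)
  have hb0 : b ≠ 0 := fun h => hbU (h ▸ U.zero_mem)
  rcases W.eq_empty_or_nonempty with rfl | hW
  · obtain ⟨γ, hγ⟩ := H.exists_v_eq hb0
    exact ⟨0, U.zero_mem, γ, hU b γ hγ, pos_of_v_eq hγ, by simp [Fits], by simp [Fits]⟩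
  obtain ⟨w₀, hw₀, hmax⟩ := W.exists_max_image (fun w => H.v (b - w)) hW
  obtain ⟨γ, hγ⟩ := H.exists_v_eq (x := b - w₀) (sub_ne_zero.2 fun h => hbW (h ▸ hw₀))
  have hγU := hU _ γ hγ
  have hγ0 := pos_of_v_eq hγ
  have hγγ := v_of_v_eq hγ
  rw [hγ] at hmax
  have hWb : ∀ w ∈ W, H.lt 1 w b ∨ H.lt 1 b w := fun w hw =>
    H.lt_or_lt_of_ne 1 fun e => hbW (e ▸ hw)
  have hsb : ∀ p δ : G, H.v (b - p) = γ → H.v δ = γ → (γ : WithTop G) ≤ H.v (p + δ - b) := by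
    intro p δ hp hδ
    have e : p + δ - b = δ - (b - p) := by abel
    rw [e]
    refine le_trans ?_ (min_le_v_sub h0 _ _)
    rw [hp, hδ, min_self]
  have smul_pos : ∀ (c : C), 0 < c → ∀ δ : G, H.lt 1 0 δ → H.v δ = γ →
      H.lt 1 0 (c • δ) ∧ H.v (c • δ) = γ := fun c hc δ hδ hv =>
    ⟨H.smul_pos 1 c δ hc hδ, by rw [H.v_smul c δ hc.ne', hv]⟩
  have smul_lt : ∀ (c d : C), c < d → ∀ δ p : G, H.lt 1 0 δ → H.lt 1 (p + c • δ) (p + d • δ) := by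
    intro c d hcd δ p hδ
    rw [← H.sub_pos', add_sub_add_left_eq_sub, ← sub_smul]
    exact H.smul_pos 1 _ δ (sub_pos.2 hcd) hδ
  have mem : ∀ (c : C) (p δ : G), p ∈ U → δ ∈ U → p + c • δ ∈ U := fun c p δ hp hδ =>
    U.add_mem hp (U.smul_mem c hδ)
  let L := W.filter fun w => H.v (b - w) = γ ∧ H.lt 1 w b
  let R := W.filter fun w => H.v (b - w) = γ ∧ H.lt 1 b w
  have memL : ∀ w, w ∈ L ↔ w ∈ W ∧ H.v (b - w) = γ ∧ H.lt 1 w b := fun w => Finset.mem_filter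
  have memR : ∀ w, w ∈ R ↔ w ∈ W ∧ H.v (b - w) = γ ∧ H.lt 1 b w := fun w => Finset.mem_filter
  rcases L.eq_empty_or_nonempty with hL | hL
  · have hR : R.Nonempty := by
      refine ⟨w₀, (memR _).2 ⟨hw₀, hγ, (hWb w₀ hw₀).resolve_left fun h => ?_⟩⟩
      exact Finset.notMem_empty w₀ (hL ▸ (memL _).2 ⟨hw₀, hγ, h⟩)
    obtain ⟨q, hq, hmin⟩ := H.exists_min 1 hR
    obtain ⟨hqW, hqγ, hbq⟩ := (memR _).1 hq
    have fit : ∀ c : C, c < 0 → H.Fits W b (q + c • γ) := by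
      intro c hc
      refine fits_of_max h0 γ hmax (hsb q _ hqγ (by rw [H.v_smul c _ hc.ne, hγγ])) hbW ?_ ?_
      · intro w hw hwγ h
        exact absurd (hL ▸ (memL _).2 ⟨hw, hwγ, h⟩) (Finset.notMem_empty w)
      · intro w hw hwγ h
        obtain ⟨h1, h2⟩ := smul_pos (-c) (neg_pos.2 hc) γ hγ0 hγγ
        exact ⟨q, (-c) • γ, hmin w ((memR _).2 ⟨hw, hwγ, h⟩), hqγ.ge, h1, h2, by
          rw [neg_smul, sub_neg_eq_add]⟩
    exact ⟨_, mem (-2) q γ (hWU hqW) hγU, _, mem (-1) q γ (hWU hqW) hγU,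
      smul_lt _ _ (by norm_num) γ q hγ0, fit _ (by norm_num), fit _ (by norm_num)⟩
  · obtain ⟨p, hp, hpmax⟩ := H.exists_max 1 hL
    obtain ⟨hpW, hpγ, hpb⟩ := (memL _).1 hp
    rcases R.eq_empty_or_nonempty with hR | hR
    · have fit : ∀ c : C, 0 < c → H.Fits W b (p + c • γ) := by
        intro c hc
        obtain ⟨h1, h2⟩ := smul_pos c hc γ hγ0 hγγ
        refine fits_of_max h0 γ hmax (hsb p _ hpγ h2) hbW ?_ ?_
        · intro w hw hwγ h
          exact ⟨p, c • γ, hpmax w ((memL _).2 ⟨hw, hwγ, h⟩), hpγ.ge, h1, h2, rfl⟩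
        · intro w hw hwγ h
          exact absurd (hR ▸ (memR _).2 ⟨hw, hwγ, h⟩) (Finset.notMem_empty w)
      exact ⟨_, mem 1 p γ (hWU hpW) hγU, _, mem 2 p γ (hWU hpW) hγU,
        smul_lt _ _ (by norm_num) γ p hγ0, fit _ (by norm_num), fit _ (by norm_num)⟩
    · obtain ⟨q, hq, hmin⟩ := H.exists_min 1 hR
      obtain ⟨hqW, hqγ, hbq⟩ := (memR _).1 hq
      have hpq : H.lt 1 0 (q - p) := H.sub_pos'.2 (H.lt_trans' hpb hbq)
      have hvpq : H.v (q - p) = γ := by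
        refine le_antisymm ?_ ?_
        · rw [← hpγ]
          refine v_le_of_lt h0 (H.sub_pos'.2 hpb) ?_
          rwa [← H.sub_pos', sub_sub_sub_cancel_right, H.sub_pos']
        · have := min_le_v_sub h0 (b - p) (b - q)
          rwa [hpγ, hqγ, min_self, sub_sub_sub_cancel_left] at this
      have fit : ∀ c : C, 0 < c → c < 1 → H.Fits W b (p + c • (q - p)) := by
        intro c hc hc1
        obtain ⟨h1, h2⟩ := smul_pos c hc _ hpq hvpq
        obtain ⟨h3, h4⟩ := smul_pos (1 - c) (sub_pos.2 hc1) _ hpq hvpq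
        refine fits_of_max h0 γ hmax (hsb p _ hpγ h2) hbW ?_ ?_
        · intro w hw hwγ h
          exact ⟨p, _, hpmax w ((memL _).2 ⟨hw, hwγ, h⟩), hpγ.ge, h1, h2, rfl⟩
        · intro w hw hwγ h
          exact ⟨q, _, hmin w ((memR _).2 ⟨hw, hwγ, h⟩), hqγ.ge, h3, h4, by module⟩
      exact ⟨_, mem (1 / 3) p _ (hWU hpW) (U.sub_mem (hWU hqW) (hWU hpW)), _,
        mem (2 / 3) p _ (hWU hpW) (U.sub_mem (hWU hqW) (hWU hpW)),
        smul_lt _ _ (by norm_num) _ p hpq, fit _ (by norm_num) (by norm_num),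
        fit _ (by norm_num) (by norm_num)⟩

/-- Any b' between `g s` and `g t` for `<₁` has the right `<₁`-position and distances, by
`v_sub_of_between`. This leaves the `<₀`-cut free, and independence meets both requirements at once.
-/
theorem Approx.sup_span_of_values_mem [IsStrictOrderedRing C] (hi : K.IsIndependent)
    {A : Submodule C G} {f : G →ₗ[C] G'} (h : H.Approx K A f U) (hAU : A ≤ U)
    (hU : ∀ x γ : G, H.v x = γ → γ ∈ U) (hbU : b ∉ U) :
    H.Approx K A f (U ⊔ Submodule.span C {b}) := by
  classical
  let _ := H.order
  let _ := K.order
  refine h.sup_span_singleton hAU (fun x _ => hU x) hbU fun l hl W hW => ?_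
  obtain ⟨s, hs, t, ht, hst, hfs, hft⟩ := exists_fits hU hbU hW
  have hsub : ∀ X Y : Finset G, (X : Set G) ⊆ U → (Y : Set G) ⊆ U →
      ∀ᶠ g in l, ∀ x ∈ X, ∀ y ∈ Y, H.Preserves K g (y - x) := fun X Y hX hY =>
    (Filter.eventually_all_finset X).2 fun x hx => (Filter.eventually_all_finset Y).2
      fun y hy => hl _ (U.sub_mem (hY hy) (hX hx))
  have hbW : ∀ w ∈ W, w ≠ b := fun w hw e => hbU (e ▸ hW hw)
  have hsU : (({s} : Finset G) : Set G) ⊆ U := by simpa using hs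
  have htU : (({t} : Finset G) : Set G) ⊆ U := by simpa using ht
  filter_upwards [hsub W W hW hW, hsub W {s} hW hsU, hsub W {t} hW htU, hsub {t} W htU hW,
    hl _ (U.sub_mem ht hs)] with g hWW hWs hWt htW hgst
  replace hWs : ∀ w ∈ W, H.Preserves K g (s - w) := fun w hw => hWs w hw s (by simp)
  replace hWt : ∀ w ∈ W, H.Preserves K g (t - w) := fun w hw => hWt w hw t (by simp)
  replace htW : ∀ w ∈ W, H.Preserves K g (w - t) := fun w hw => htW t (by simp) w hw
  obtain ⟨b', hb'⟩ := MultiOrder.IsIndependent.exists_between hi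
    (fun i => if i = 0 then (W.filter (H.lt 0 · b)).image g else {g s})
    (fun i => if i = 0 then (W.filter (H.lt 0 b ·)).image g else {g t}) (by
      intro i
      fin_cases i
      · intro x hx y hy
        replace hx : x ∈ (W.filter (H.lt 0 · b)).image g := hx
        replace hy : y ∈ (W.filter (H.lt 0 b ·)).image g := hy
        obtain ⟨x', hx', rfl⟩ := Finset.mem_image.1 hx
        obtain ⟨y', hy', rfl⟩ := Finset.mem_image.1 hy
        obtain ⟨hxW, hxb⟩ := Finset.mem_filter.1 hx'
        obtain ⟨hyW, hyb⟩ := Finset.mem_filter.1 hy'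
        exact (hWW x' hxW y' hyW).lt (H.lt_trans' hxb hyb)
      · simpa using hgst.lt hst)
  obtain ⟨hs', ht'⟩ : K.lt 1 (g s) b' ∧ K.lt 1 b' (g t) := by simpa using hb' 1
  obtain ⟨hl0, hr0⟩ : (∀ w ∈ W, H.lt 0 w b → K.lt 0 (g w) b') ∧
      ∀ w ∈ W, H.lt 0 b w → K.lt 0 b' (g w) :=
    ⟨fun w hw h => (hb' 0).1 _ (Finset.mem_image_of_mem g (Finset.mem_filter.2 ⟨hw, h⟩)),
      fun w hw h => (hb' 0).2 _ (Finset.mem_image_of_mem g (Finset.mem_filter.2 ⟨hw, h⟩))⟩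
  have hl1 : ∀ w ∈ W, H.lt 1 w b → K.lt 1 (g w) (g s) := fun w hw h =>
    (hWs w hw).lt ((hfs w hw).1 h)
  have hr1 : ∀ w ∈ W, H.lt 1 b w → K.lt 1 (g t) (g w) := fun w hw h =>
    (htW w hw).lt ((hft w hw).2.1 h)
  refine ⟨b', fun g' hg' hgb w hw => ?_⟩
  have e : g' (b - w) = b' - g w := by rw [map_sub, hgb, hg' w (hW hw)]
  refine ⟨fun i => ?_, fun i => ?_, ?_⟩
  · rw [e, H.sub_pos', K.sub_pos']
    fin_cases i
    · exact hl0 w hw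
    · exact fun h => K.lt_trans' (hl1 w hw h) hs'
  · rw [e, H.sub_neg', K.sub_neg']
    fin_cases i
    · exact hr0 w hw
    · exact fun h => K.lt_trans' ht' (hr1 w hw h)
  · obtain ⟨γ, hγ⟩ := H.exists_v_eq (sub_ne_zero.2 (hbW w hw).symm)
    rw [e, hγ, WithTop.map_coe, hg' γ (hU _ γ hγ)]
    refine v_sub_of_between (H := K) rfl ?_ ?_ ?_ hs' ht'
    · rw [← map_sub, (hWs w hw).map_v, (hfs w hw).2.2, hγ, WithTop.map_coe]
    · rw [← map_sub, (hWt w hw).map_v, (hft w hw).2.2, hγ, WithTop.map_coe]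
    · exact (H.lt_or_lt_of_ne 1 (hbW w hw)).imp (hl1 w hw) (hr1 w hw)

/-- Every finite part of a Hamel space over a substructure can be realized in an independent and
dense Hamel space. -/
theorem Approx.top [IsStrictOrderedRing C] (hi : K.IsIndependent) (hd : K.IsDense)
    {A : Submodule C G} {f : G →ₗ[C] G'} (hA : H.VClosed A) (h : H.Approx K A f A) :
    H.Approx K A f ⊤ := by
  classical
  let _ := H.order
  obtain ⟨U, hAU, hmax⟩ := zorn_le_nonempty₀ {U | A ≤ U ∧ H.VClosed U ∧ H.Approx K A f U}
    (fun c hc hchain U₀ hU₀ => by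
      have hdir : DirectedOn (· ≤ ·) c := hchain.directedOn
      refine ⟨sSup c, ⟨(hc hU₀).1.trans (le_sSup hU₀), fun x hx γ hγ => ?_,
        approx_of_finite fun E hE => ?_⟩, fun z hz => le_sSup hz⟩
      · obtain ⟨V, hV, hxV⟩ := (Submodule.mem_sSup_of_directed ⟨U₀, hU₀⟩ hdir).1 hx
        exact (le_sSup hV : V ≤ _) ((hc hV).2.1 x hxV γ hγ)
      -- A finite subset of the union of the chain lies in one of its members, so approximability
      -- passes to the union.
      · obtain ⟨V, hV, hEV⟩ : ∃ V ∈ c, (E : Set G) ⊆ V := by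
          induction E using Finset.induction_on with
          | empty => exact ⟨U₀, hU₀, by simp⟩
          | insert a E _ ih =>
            rw [Finset.coe_insert, Set.insert_subset_iff] at hE
            obtain ⟨V, hV, hEV⟩ := ih hE.2
            obtain ⟨V', hV', haV⟩ := (Submodule.mem_sSup_of_directed ⟨U₀, hU₀⟩ hdir).1 hE.1
            obtain ⟨V'', hV'', h1, h2⟩ := hdir V hV V' hV'
            refine ⟨V'', hV'', ?_⟩
            rw [Finset.coe_insert, Set.insert_subset_iff]
            exact ⟨h2 haV, hEV.trans h1⟩
        exact (hc hV).2.2.exists_of_finite E hEV) A ⟨le_rfl, hA, h⟩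
  obtain ⟨⟨-, hUv, hUa⟩, hU⟩ := hmax
  have key : ∀ b, H.VClosed (U ⊔ Submodule.span C {b}) →
      H.Approx K A f (U ⊔ Submodule.span C {b}) → b ∈ U := fun b h1 h2 =>
    hU ⟨hAU.trans le_sup_left, h1, h2⟩ le_sup_left
      (Submodule.mem_sup_right (Submodule.mem_span_singleton_self b))
  -- Values come first: once U contains them all, every larger subspace is automatically `v`-closed
  -- and the second kind of extension applies.
  have hval : ∀ x γ : G, H.v x = γ → γ ∈ U := by
    intro x γ hγ
    by_contra hγU
    exact hγU (key γ (hUv.sup_span_singleton rfl (v_of_v_eq hγ) hγU)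
      (hUa.sup_span_value hi hd hAU hUv (v_of_v_eq hγ) hγU))
  have : U = ⊤ := by
    refine (Submodule.eq_top_iff').2 fun b => ?_
    by_contra hbU
    exact hbU (key b (fun x _ γ hγ => Submodule.mem_sup_left (hval x γ hγ))
      (hUa.sup_span_of_values_mem hi hAU hval hbU))
  rwa [this] at hUa

end HamelSpace

open FirstOrder FirstOrder.Language

namespace HamelSpace

/-! ### From approximations to terms and formulas. -/

section Transfer

variable {C : Type u} {G : Type v} {G' : Type w} [Field C] [LinearOrder C] [AddCommGroup G]
  [Module C G] [AddCommGroup G'] [Module C G'] {H : HamelSpace C G} {K : HamelSpace C G'}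

/-- The value of a term at a tuple of elements of `G ∪ {∞}`. -/
def eval (H : HamelSpace C G) {β : Type*} (v : β → WithTop G) (t : (LHam C).Term β) : WithTop G :=
  Term.realize (M := H.Carrier) v t

/-- Satisfaction of a formula at tuples of elements of `G ∪ {∞}`. -/
def Sat (H : HamelSpace C G) {β : Type*} {n : ℕ} (φ : (LHam C).BoundedFormula β n)
    (v : β → WithTop G) (xs : Fin n → WithTop G) : Prop :=
  φ.Realize (M := H.Carrier) v xs

theorem sat_imp {β : Type*} {n : ℕ} {φ ψ : (LHam C).BoundedFormula β n} {v : β → WithTop G}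
    {xs : Fin n → WithTop G} : H.Sat (φ.imp ψ) v xs ↔ (H.Sat φ v xs → H.Sat ψ v xs) :=
  Iff.rfl

theorem sat_equal {β : Type*} {n : ℕ} {s t : (LHam C).Term (β ⊕ Fin n)} {v : β → WithTop G}
    {xs : Fin n → WithTop G} :
    H.Sat (s =' t) v xs ↔ H.eval (Sum.elim v xs) s = H.eval (Sum.elim v xs) t :=
  Iff.rfl

theorem sat_rel {β : Type*} {n : ℕ} {i : Fin 2} {ts : Fin 2 → (LHam C).Term (β ⊕ Fin n)}
    {v : β → WithTop G} {xs : Fin n → WithTop G} :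
    H.Sat (BoundedFormula.rel (L := LHam C) (HamRel.lt i) ts) v xs ↔
      topLT (H.lt i) (H.eval (Sum.elim v xs) (ts 0)) (H.eval (Sum.elim v xs) (ts 1)) :=
  Iff.rfl

theorem eval_add {β : Type*} (v : β → WithTop G) (s t : (LHam C).Term β) :
    H.eval v (addT s t) = H.eval v s + H.eval v t :=
  realize_addT (M := H.Carrier) v s t

theorem eval_smul {β : Type*} (v : β → WithTop G) (c : C) (t : (LHam C).Term β) :
    H.eval v (smulT c t) = WithTop.map (fun g : G => c • g) (H.eval v t) :=
  realize_smulT (M := H.Carrier) v c t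

theorem eval_val {β : Type*} (v : β → WithTop G) (t : (LHam C).Term β) :
    H.eval v (valT t) = topVal H.v (H.eval v t) :=
  realize_valT (M := H.Carrier) v t

theorem eval_zero {β : Type*} (v : β → WithTop G) :
    H.eval v (zeroT : (LHam C).Term β) = ((0 : G) : WithTop G) :=
  realize_zeroT (M := H.Carrier) v

theorem eval_infty {β : Type*} (v : β → WithTop G) :
    H.eval v (inftyT : (LHam C).Term β) = ⊤ :=
  realize_inftyT (M := H.Carrier) v

variable {l : Filter (G →ₗ[C] G')}

/-- No single g need be a homomorphism. Linear operations commute with every g, while each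
occurrence of `v` in the term adds one vector that must be preserved. There are finitely many, so a
filter can handle them. -/
theorem eventually_eval (hl : ∀ x : G, ∀ᶠ g in l, H.Preserves K g x) {β : Type*}
    (v : β → WithTop G) (t : (LHam C).Term β) :
    ∀ᶠ g : G →ₗ[C] G' in l, K.eval (WithTop.map g ∘ v) t = WithTop.map g (H.eval v t) := by
  induction t with
  | var i => exact Filter.Eventually.of_forall fun g => rfl
  | func f ts ih =>
    cases f with
    | zero =>
      refine Filter.Eventually.of_forall fun g => ?_
      change ((0 : G') : WithTop G') = WithTop.map g ((0 : G) : WithTop G)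
      rw [WithTop.map_coe, map_zero]
    | infty => exact Filter.Eventually.of_forall fun g => rfl
    | add =>
      filter_upwards [ih 0, ih 1] with g h0 h1
      change K.eval (WithTop.map g ∘ v) (ts 0) + K.eval (WithTop.map g ∘ v) (ts 1) =
        WithTop.map g (H.eval v (ts 0) + H.eval v (ts 1))
      rw [h0, h1]
      exact (WithTop.map_add g _ _).symm
    | smul c =>
      filter_upwards [ih 0] with g h0
      change WithTop.map (fun g : G' => c • g) (K.eval (WithTop.map g ∘ v) (ts 0)) =
        WithTop.map g (WithTop.map (fun g : G => c • g) (H.eval v (ts 0)))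
      rw [h0, WithTop.map_map, WithTop.map_map]
      congr 1
      ext x
      exact (map_smul g c x).symm
    | val =>
      have h2 : ∀ᶠ g : G →ₗ[C] G' in l, topVal K.v (WithTop.map g (H.eval v (ts 0))) =
          WithTop.map g (topVal H.v (H.eval v (ts 0))) := by
        cases hx : H.eval v (ts 0) with
        | top => exact Filter.Eventually.of_forall fun g => rfl
        | coe x =>
          filter_upwards [hl x] with g hg
          exact hg.map_v
      filter_upwards [ih 0, h2] with g h0 h2
      change topVal K.v (K.eval (WithTop.map g ∘ v) (ts 0)) =
        WithTop.map g (topVal H.v (H.eval v (ts 0)))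
      rw [h0, h2]

theorem eventually_realize_qf (hl : ∀ x : G, ∀ᶠ g in l, H.Preserves K g x)
    {β : Type*} {n : ℕ} (φ : (LHam C).BoundedFormula β n)
    (hφ : φ.IsQF) (v : β → WithTop G) (xs : Fin n → WithTop G) :
    ∀ᶠ g : G →ₗ[C] G' in l, K.Sat φ (WithTop.map g ∘ v) (WithTop.map g ∘ xs) ↔
      H.Sat φ v xs := by
  have hp : ∀ x y : WithTop G, ∀ᶠ g : G →ₗ[C] G' in l,
      (WithTop.map g x = WithTop.map g y ↔ x = y) ∧
      ∀ i, topLT (K.lt i) (WithTop.map g x) (WithTop.map g y) ↔ topLT (H.lt i) x y := by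
    intro x y
    cases x with
    | top =>
      refine Filter.Eventually.of_forall fun g => ⟨?_, fun i =>
        iff_of_false (not_top_topLT _ _) (not_top_topLT _ _)⟩
      cases y with
      | top => simp
      | coe y => simp
    | coe x =>
      cases y with
      | top => exact Filter.Eventually.of_forall fun g => ⟨by simp, fun i =>
          iff_of_true (topLT_top _ _) (topLT_top _ _)⟩
      | coe y =>
        -- Comparing x with y is a question about the sign of the single vector `y - x`.
        filter_upwards [hl (y - x)] with g hg
        simp only [WithTop.map_coe, WithTop.coe_inj, topLT_coe]
        exact ⟨hg.eq_iff, fun i => hg.lt_iff⟩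
  induction hφ with
  | falsum => exact Filter.Eventually.of_forall fun g => Iff.rfl
  | of_isAtomic h =>
    cases h with
    | equal s t =>
      filter_upwards [eventually_eval hl (Sum.elim v xs) s,
        eventually_eval hl (Sum.elim v xs) t,
        hp (H.eval (Sum.elim v xs) s) (H.eval (Sum.elim v xs) t)] with g h1 h2 h3
      rw [sat_equal, sat_equal, ← Sum.comp_elim, h1, h2]
      exact h3.1
    | rel R ts =>
      cases R with
      | lt i =>
        filter_upwards [eventually_eval hl (Sum.elim v xs) (ts 0),
          eventually_eval hl (Sum.elim v xs) (ts 1),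
          hp (H.eval (Sum.elim v xs) (ts 0)) (H.eval (Sum.elim v xs) (ts 1))] with g h1 h2 h3
        refine (sat_rel.trans ?_).trans sat_rel.symm
        rw [← Sum.comp_elim, h1, h2]
        exact h3.2 i
  | imp _ _ h1 h2 =>
    filter_upwards [h1, h2] with g h1 h2
    rw [sat_imp, sat_imp, h1, h2]

end Transfer

/-! ### Generated substructures and transfer of solutions. -/

section Base

variable {C : Type u} {G : Type v} {G' : Type w} [Field C] [LinearOrder C] [AddCommGroup G]
  [Module C G] [AddCommGroup G'] [Module C G'] {H : HamelSpace C G} {K : HamelSpace C G'}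
  {β : Type*}

/-- The values of terms at a tuple. -/
def termSpan (H : HamelSpace C G) (v : β → WithTop G) : Submodule C G where
  carrier := {x | ∃ t : (LHam C).Term β, H.eval v t = (x : WithTop G)}
  add_mem' := by
    rintro x y ⟨s, hs⟩ ⟨t, ht⟩
    exact ⟨addT s t, by rw [eval_add, hs, ht, WithTop.coe_add]⟩
  zero_mem' := ⟨zeroT, eval_zero v⟩
  smul_mem' := by
    rintro c x ⟨t, ht⟩
    exact ⟨smulT c t, by rw [eval_smul, ht, WithTop.map_coe]⟩

theorem vClosed_termSpan (v : β → WithTop G) : H.VClosed (H.termSpan v) := by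
  rintro x ⟨t, ht⟩ γ hγ
  refine ⟨valT t, ?_⟩
  rw [eval_val, ht]
  exact hγ

/-- Tuples with the same quantifier-free type generate isomorphic substructures. -/
theorem exists_linearMap_termSpan (v : β → WithTop G) (v' : β → WithTop G')
    (heq : ∀ s t : (LHam C).Term β, H.eval v s = H.eval v t ↔ K.eval v' s = K.eval v' t)
    (hlt : ∀ (i : Fin 2) (s t : (LHam C).Term β),
      topLT (H.lt i) (H.eval v s) (H.eval v t) → topLT (K.lt i) (K.eval v' s) (K.eval v' t)) :
    ∃ f : G →ₗ[C] G', (∀ i, WithTop.map f (v i) = v' i) ∧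
      (∀ i, ∀ x : G, v i = (x : WithTop G) → x ∈ H.termSpan v) ∧
      ∀ x ∈ H.termSpan v, H.Preserves K f x := by
  have hfin : ∀ t : (LHam C).Term β, H.eval v t = (⊤ : WithTop G) ↔
      K.eval v' t = (⊤ : WithTop G') := by
    intro t
    have := heq t inftyT
    rwa [eval_infty, eval_infty] at this
  -- A vector is sent to the value of any term representing it. Equalities in the quantifier-free
  -- type make this independent of the term, and comparison with `∞` keeps it finite.
  have hex : ∀ x : H.termSpan v, ∃ y : G', ∀ t : (LHam C).Term β,
      H.eval v t = ((x : G) : WithTop G) → K.eval v' t = (y : WithTop G') := by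
    rintro ⟨x, s, hs⟩
    have h1 : K.eval v' s ≠ (⊤ : WithTop G') := by
      rw [← (hfin s).ne, hs]
      exact WithTop.coe_ne_top
    obtain ⟨y, hy⟩ : ∃ y : G', K.eval v' s = (y : WithTop G') :=
      ⟨_, (WithTop.coe_untop _ h1).symm⟩
    exact ⟨y, fun t ht => ((heq t s).1 (ht.trans hs.symm)).trans hy⟩
  choose f hf using hex
  have hinj : ∀ x y : G', (x : WithTop G') = (y : WithTop G') → x = y :=
    fun x y h => WithTop.coe_injective h
  let F : H.termSpan v →ₗ[C] G' :=
    { toFun := f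
      map_add' := by
        intro x y
        obtain ⟨s, hs⟩ := x.2
        obtain ⟨t, ht⟩ := y.2
        have := hf (x + y) (addT s t) (by
          rw [eval_add, hs, ht, Submodule.coe_add, WithTop.coe_add])
        rw [eval_add, hf x s hs, hf y t ht] at this
        exact (hinj _ _ this).symm
      map_smul' := by
        intro c x
        obtain ⟨t, ht⟩ := x.2
        have := hf (c • x) (smulT c t) (by
          rw [eval_smul, ht, Submodule.coe_smul, WithTop.map_coe])
        rw [eval_smul, hf x t ht] at this
        exact (hinj _ _ this).symm }
  obtain ⟨E, hE⟩ := F.exists_extend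
  have hEf : ∀ (x : G) (t : (LHam C).Term β), H.eval v t = (x : WithTop G) →
      K.eval v' t = (E x : WithTop G') := by
    intro x t ht
    have h1 : E x = f ⟨x, t, ht⟩ := LinearMap.congr_fun hE ⟨x, t, ht⟩
    rw [h1]
    exact hf ⟨x, t, ht⟩ t ht
  refine ⟨E, fun i => ?_, fun i x hx => ⟨Term.var i, hx⟩, ?_⟩
  · cases hx : (v i : WithTop G) with
    | top => exact ((hfin (Term.var i)).1 hx).symm
    | coe x => exact (hEf x (Term.var i) hx).symm
  · rintro x ⟨t, ht⟩
    refine ⟨fun i hi => ?_, fun i hi => ?_, ?_⟩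
    · have := hlt i zeroT t (by
        rw [eval_zero, ht]
        exact (topLT_coe _ _ _).2 hi)
      rw [eval_zero, hEf x t ht] at this
      exact (topLT_coe _ _ _).1 this
    · have := hlt i t zeroT (by
        rw [eval_zero, ht]
        exact (topLT_coe _ _ _).2 hi)
      rw [eval_zero, hEf x t ht] at this
      exact (topLT_coe _ _ _).1 this
    · have h1 : H.eval v (valT t) = H.v x := by
        rw [eval_val, ht]
        rfl
      have h2 : K.eval v' (valT t) = K.v (E x) := by
        rw [eval_val, hEf x t ht]
        rfl
      rw [← h2]
      cases hγ : H.v x with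
      | top => exact (hfin _).1 (h1.trans hγ)
      | coe γ => exact hEf γ _ (h1.trans hγ)

/-- Quantifier-free formulas over a tuple that hold in a Hamel space can be realized over any tuple
of the same quantifier-free type in an independent and dense Hamel space. -/
theorem exists_realize_of_qf [IsStrictOrderedRing C] (hi : K.IsIndependent) (hd : K.IsDense)
    {n : ℕ} (x : β → WithTop G) (y : Fin n → WithTop G) (x' : β → WithTop G')
    (y' : Fin n → WithTop G')
    (hqf : ∀ χ : (LHam C).BoundedFormula β n, χ.IsQF → H.Sat χ x y → K.Sat χ x' y')
    {m : ℕ} (φ : (LHam C).BoundedFormula β (n + m)) (hφ : φ.IsQF) (b : Fin m → WithTop G)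
    (h : H.Sat φ x (Fin.append y b)) :
    ∃ c : Fin m → WithTop G', K.Sat φ x' (Fin.append y' c) := by
  have hqf' : ∀ χ : (LHam C).BoundedFormula β n, χ.IsQF →
      (H.Sat χ x y ↔ K.Sat χ x' y') := fun χ hχ => by
    refine ⟨hqf χ hχ, fun h' => ?_⟩
    by_contra hn
    exact hqf χ.not hχ.not hn h'
  obtain ⟨f, hfv, hfm, hfp⟩ := exists_linearMap_termSpan (H := H) (K := K) (Sum.elim x y)
    (Sum.elim x' y')
    (fun s t => by
      have := hqf' (s =' t) (BoundedFormula.IsAtomic.equal s t).isQF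
      rwa [sat_equal, sat_equal] at this)
    (fun i s t => by
      exact hqf (BoundedFormula.rel (L := LHam C) (HamRel.lt i) ![s, t])
        (BoundedFormula.IsAtomic.rel _ _).isQF)
  -- The map f preserves the generated substructure exactly, so the principal filter at f is the
  -- initial approximation.
  obtain ⟨l, hl, hlA, hlU⟩ := Approx.top hi hd (vClosed_termSpan (Sum.elim x y)) (f := f)
    (K := K) ⟨pure f, inferInstance, by simp, by simpa using hfp⟩
  obtain ⟨g, hg, hgA⟩ := ((eventually_realize_qf (fun x => hlU x trivial) φ hφ x
    (Fin.append y b)).and hlA).exists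
  have hgv : ∀ i, WithTop.map g (Sum.elim x y i) = Sum.elim x' y' i := by
    intro i
    rw [← hfv i]
    cases hx : (Sum.elim x y i : WithTop G) with
    | top => rfl
    | coe z =>
      change ((g z : G') : WithTop G') = f z
      rw [hgA z (hfm i z hx)]
  refine ⟨WithTop.map g ∘ b, ?_⟩
  have h1 : x' = WithTop.map g ∘ x := funext fun i => (hgv (Sum.inl i)).symm
  have h2 : Fin.append y' (WithTop.map g ∘ b) = WithTop.map g ∘ Fin.append y b := by
    ext i
    refine Fin.addCases (fun i => ?_) (fun i => ?_) i
    · simpa using (hgv (Sum.inr i)).symm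
    · simp
  rw [h1, h2]
  exact hg.2 h

/-- Quantifier-free sentences have the same truth value in all independent and dense Hamel
spaces. -/
theorem sat_iff_of_isEmpty [IsStrictOrderedRing C] [IsEmpty β] (hi : K.IsIndependent)
    (hd : K.IsDense) (φ : (LHam C).BoundedFormula β 0) (hφ : φ.IsQF) (x : β → WithTop G)
    (y : Fin 0 → WithTop G) (x' : β → WithTop G') (y' : Fin 0 → WithTop G') :
    K.Sat φ x' y' ↔ H.Sat φ x y := by
  have h0 : H.Preserves K (0 : G →ₗ[C] G') 0 :=
    ⟨fun i h => absurd h (H.lt_irrefl' i 0), fun i h => absurd h (H.lt_irrefl' i 0), by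
      rw [LinearMap.zero_apply, v_zero, v_zero, WithTop.map_top]⟩
  have hbot : H.VClosed (⊥ : Submodule C G) := by
    intro x hx γ hγ
    rw [(Submodule.mem_bot C).1 hx, v_zero] at hγ
    exact absurd hγ WithTop.top_ne_coe
  obtain ⟨l, hl, -, hlU⟩ := Approx.top hi hd hbot (f := (0 : G →ₗ[C] G'))
    ⟨pure 0, inferInstance, by simp, by simpa using h0⟩
  obtain ⟨g, hg⟩ := (eventually_realize_qf (fun x => hlU x trivial) φ hφ x y).exists
  rwa [Subsingleton.elim x' (WithTop.map g ∘ x), Subsingleton.elim y' (WithTop.map g ∘ y)]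

end Base

end HamelSpace

/-! ### Quantifier elimination, and completeness relative to satisfiability. -/

section QE

variable {C : Type u} [Field C] [LinearOrder C] [IsStrictOrderedRing C]

theorem comp_fin_append {α β : Type*} {m n : ℕ} (g : α → β) (x : Fin m → α) (y : Fin n → α) :
    g ∘ Fin.append x y = Fin.append (g ∘ x) (g ∘ y) := by
  ext i
  exact Fin.addCases (fun i => by simp) (fun i => by simp) i

theorem exists_realize_of_models {β : Type*} {M N : Type u} [(LHam C).Structure M]
    [(LHam C).Structure N] [hM : M ⊨ THam C] [hN : N ⊨ THam C] {n : ℕ}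
    (x : β → M) (y : Fin n → M) (x' : β → N) (y' : Fin n → N)
    (hqf : ∀ χ : (LHam C).BoundedFormula β n, χ.IsQF → χ.Realize x y → χ.Realize x' y')
    {m : ℕ} (φ : (LHam C).BoundedFormula β (n + m)) (hφ : φ.IsQF) (b : Fin m → M)
    (h : φ.Realize x (Fin.append y b)) : ∃ c : Fin m → N, φ.Realize x' (Fin.append y' c) := by
  obtain ⟨G, _, _, H, -, -, ⟨e⟩⟩ := (models_iff M).1 hM
  obtain ⟨G', _, _, K, hi, hd, ⟨e'⟩⟩ := (models_iff N).1 hN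
  obtain ⟨c, hc⟩ := HamelSpace.exists_realize_of_qf hi hd (e ∘ x) (e ∘ y) (e' ∘ x') (e' ∘ y')
    (fun χ hχ h => (StrongHomClass.realize_boundedFormula e' χ).2
      (hqf χ hχ ((StrongHomClass.realize_boundedFormula e χ).1 h))) φ hφ (e ∘ b) (by
      have := (StrongHomClass.realize_boundedFormula e φ).2 h
      rwa [comp_fin_append] at this)
  refine ⟨e'.symm ∘ c, (StrongHomClass.realize_boundedFormula e' φ).1 ?_⟩
  rw [comp_fin_append]
  have : e' ∘ e'.symm ∘ c = c := funext fun i => e'.apply_symm_apply (c i)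
  rw [this]
  exact hc

theorem exists_isQF_iff_of_tHam {α : Type} {n : ℕ} (φ : (LHam C).BoundedFormula α n) :
    ∃ ψ : (LHam C).BoundedFormula α n, ψ.IsQF ∧ THam C ⊨ᵇ φ.iff ψ := by
  refine exists_isQF_iff_of_ex (fun n M N x y x' y' hqf φ hφ b h => ?_) φ
  obtain ⟨c, hc⟩ := exists_realize_of_models x y x' y' hqf (m := 1) φ hφ (fun _ => b) (by
    rwa [Fin.append_right_eq_snoc])
  rw [Fin.append_right_eq_snoc] at hc
  exact ⟨_, hc⟩

/-- Every sentence is equivalent to a quantifier-free one, whose truth value is the same in all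
models by `sat_iff_of_isEmpty`. -/
theorem isComplete_of_isSatisfiable (h : (THam C).IsSatisfiable) : (THam C).IsComplete := by
  refine ⟨h, fun φ => ?_⟩
  obtain ⟨ψ, hψ, hT⟩ := exists_isQF_iff_of_tHam φ
  obtain ⟨M₀⟩ := h
  have hT' : ∀ (M : Theory.ModelType.{u, 0, u} (THam C)) (x : Empty → M) (y : Fin 0 → M),
      BoundedFormula.Realize φ x y ↔ ψ.Realize x y := fun M x y =>
    BoundedFormula.realize_iff.1 (hT M x y)
  have key : ∀ (M N : Theory.ModelType.{u, 0, u} (THam C)) (x : Empty → M) (y : Fin 0 → M)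
      (x' : Empty → N) (y' : Fin 0 → N), ψ.Realize x' y' ↔ ψ.Realize x y := by
    intro M N x y x' y'
    obtain ⟨G, _, _, H, -, -, ⟨e⟩⟩ := (models_iff M).1 M.is_model
    obtain ⟨G', _, _, K, hi, hd, ⟨e'⟩⟩ := (models_iff N).1 N.is_model
    exact ((StrongHomClass.realize_boundedFormula e' ψ).symm.trans
      (HamelSpace.sat_iff_of_isEmpty hi hd ψ hψ (e ∘ x) (e ∘ y) (e' ∘ x') (e' ∘ y'))).trans
      (StrongHomClass.realize_boundedFormula e ψ)
  by_cases h₀ : ψ.Realize (default : Empty → M₀) default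
  · exact Or.inl fun N x' y' => (hT' N x' y').2 ((key M₀ N _ _ x' y').2 h₀)
  · exact Or.inr fun N x' y' => BoundedFormula.realize_not.2
      fun h => h₀ ((key M₀ N _ _ x' y').1 ((hT' N x' y').1 h))

end QE

/-! ### Lexicographic orders. -/

section LexOrder

variable {C G J : Type*} [Field C] [LinearOrder C] [IsStrictOrderedRing C] [AddCommGroup G]
  [Module C G] [LinearOrder J]

/-- The lexicographic order of a vector space with respect to coordinates indexed by a linearly
ordered set. -/
def lexOrder (e : G ≃ₗ[C] (J →₀ C)) : MultiOrder Unit C G where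
  lt _ x y := ∃ i, (∀ j, j < i → e x j = e y j) ∧ e x i < e y i
  strictTotal _ :=
    { trichotomous := fun x y h1 h2 => by
        rcases lt_trichotomy (toLex (e x)) (toLex (e y)) with h | h | h
        · exact absurd (Finsupp.Lex.lt_iff.1 h) h1
        · exact e.injective (toLex.injective h)
        · exact absurd (Finsupp.Lex.lt_iff.1 h) h2
      irrefl := by
        rintro x ⟨i, -, h⟩
        exact lt_irrefl _ h
      trans := fun x y z hxy hyz =>
        Finsupp.Lex.lt_iff.1 ((Finsupp.Lex.lt_iff.2 hxy : toLex (e x) < toLex (e y)).trans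
          (Finsupp.Lex.lt_iff.2 hyz : toLex (e y) < toLex (e z))) }
  add_lt_add := by
    rintro _ x y z ⟨i, h1, h2⟩
    exact ⟨i, fun j hj => by simp [h1 j hj], by simpa using h2⟩
  smul_pos := by
    rintro _ c x hc ⟨i, h1, h2⟩
    refine ⟨i, fun j hj => ?_, ?_⟩
    · have := h1 j hj
      rw [map_zero, Finsupp.zero_apply] at this
      simp [← this]
    · rw [map_zero, Finsupp.zero_apply] at h2
      simpa using mul_pos hc h2

theorem lexOrder_pos_iff {e : G ≃ₗ[C] (J →₀ C)} {x : G} :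
    (lexOrder e).lt () 0 x ↔ ∃ i, (∀ j, j < i → e x j = 0) ∧ 0 < e x i := by
  simp [lexOrder, eq_comm]

/-- The smallest index dominates. All of y lives strictly beyond the leading index of x, so y is
infinitesimal relative to x. -/
theorem lexOrder_pos_add {e : G ≃ₗ[C] (J →₀ C)} {x y : G} (hx : (lexOrder e).lt () 0 x)
    (h : ∀ i ∈ (e y).support, ∃ j ∈ (e x).support, j < i) : (lexOrder e).lt () 0 (x + y) := by
  obtain ⟨i, h1, h2⟩ := lexOrder_pos_iff.1 hx
  have hy : ∀ j, j ≤ i → e y j = 0 := by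
    intro j hj
    by_contra hn
    obtain ⟨k, hk, hkj⟩ := h j (Finsupp.mem_support_iff.2 hn)
    exact Finsupp.mem_support_iff.1 hk (h1 k (hkj.trans_le hj))
  exact lexOrder_pos_iff.2 ⟨i, fun j hj => by simp [h1 j hj, hy j hj.le], by
    simpa [hy i le_rfl] using h2⟩

theorem lexOrder_min_support {e : G ≃ₗ[C] (J →₀ C)} {x y : G} (hx : (lexOrder e).lt () 0 x)
    (hxy : (lexOrder e).lt () x y) : (e y).support.min ≤ (e x).support.min := by
  obtain ⟨m, hm1, hm2⟩ := lexOrder_pos_iff.1 hx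
  obtain ⟨k, hk1, hk2⟩ := hxy
  -- Here m is the leading index of x and k the first index where x and y differ.
  have hmem : min m k ∈ (e y).support := by
    rw [Finsupp.mem_support_iff]
    rcases lt_trichotomy m k with h | h | h
    · rw [min_eq_left h.le, ← hk1 m h]
      exact hm2.ne'
    · rw [← h, min_self]
      rw [← h] at hk2
      exact (hm2.trans hk2).ne'
    · rw [min_eq_right h.le]
      rw [hm1 k h] at hk2
      exact hk2.ne'
  refine (Finset.min_le hmem).trans (Finset.le_min fun j hj => WithTop.coe_le_coe.2 ?_)
  refine (min_le_left m k).trans ?_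
  by_contra hn
  exact Finsupp.mem_support_iff.1 hj (hm1 j (not_le.1 hn))

end LexOrder

/-! ### The Hamel space of a vector space with dense basis. -/

section DenseBasis

variable {C G Γ : Type*} [Field C] [LinearOrder C] [IsStrictOrderedRing C] [AddCommGroup G]
  [Module C G] [LinearOrder Γ] (O : MultiOrder Unit C G) (b : Module.Basis Γ C G)
  (hb : ∀ γ δ, γ < δ → O.lt () (b γ) (b δ))

theorem topLE_map_basis {C G Γ : Type*} [Field C] [LinearOrder C] [AddCommGroup G]
    [Module C G] [LinearOrder Γ] (O : MultiOrder Unit C G) (b : Module.Basis Γ C G)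
    (hb : ∀ γ δ, γ < δ → O.lt () (b γ) (b δ)) {p q : WithTop Γ} (h : p ≤ q) :
    topLE (O.lt ()) (p.map b) (q.map b) := by
  rcases h.lt_or_eq with h | rfl
  · left
    cases p with
    | top => exact absurd h not_top_lt
    | coe p =>
      cases q with
      | top => exact topLT_top _ _
      | coe q => exact (topLT_coe _ _ _).2 (hb p q (WithTop.coe_lt_coe.1 h))
  · exact Or.inr rfl

theorem min_support_repr_basis (γ : Γ) : (b.repr (b γ)).support.min = γ := by
  rw [b.repr_self, Finsupp.support_single γ one_ne_zero, Finset.min_singleton]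

theorem lexOrder_pos_basis (γ : Γ) : (lexOrder b.repr).lt () 0 (b γ) := by
  refine lexOrder_pos_iff.2 ⟨γ, fun j hj => ?_, ?_⟩
  · rw [b.repr_self, Finsupp.single_eq_of_ne hj.ne]
  · rw [b.repr_self, Finsupp.single_eq_same]
    exact one_pos

/-- The Hamel space of an ordered vector space with a basis: the valuation sends a vector to the
smallest basis vector occurring in it, and the second order is lexicographic. -/
noncomputable def ofBasis : HamelSpace C G where
  lt := ![O.lt (), (lexOrder b.repr).lt ()]
  strictTotal i := by
    fin_cases i
    exacts [O.strictTotal (), (lexOrder b.repr).strictTotal ()]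
  add_lt_add i := by
    fin_cases i
    exacts [O.add_lt_add (), (lexOrder b.repr).add_lt_add ()]
  smul_pos i := by
    fin_cases i
    exacts [O.smul_pos (), (lexOrder b.repr).smul_pos ()]
  v x := (b.repr x).support.min.map b
  v_eq_top x := by
    rw [WithTop.map_eq_top_iff, Finset.min_eq_top, Finsupp.support_eq_empty]
    exact b.repr.map_eq_zero_iff
  v_add x y := by
    have h : min (b.repr x).support.min (b.repr y).support.min ≤ (b.repr (x + y)).support.min := by
      rw [map_add, ← Finset.min_union]
      exact Finset.min_mono Finsupp.support_add
    exact (min_le_iff.1 h).imp (topLE_map_basis O b hb) (topLE_map_basis O b hb)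
  v_smul c x hc := by
    rw [map_smul, Finsupp.support_smul_eq hc]
  v_convex x y hx hxy := topLE_map_basis O b hb (lexOrder_min_support hx hxy)
  v_idem x := by
    cases (b.repr x).support.min with
    | top => rfl
    | coe γ =>
      change (b.repr (b γ)).support.min.map b = _
      rw [min_support_repr_basis]
  v_pos x := by
    cases (b.repr x).support.min with
    | top => exact topLT_top _ _
    | coe γ => exact (topLT_coe _ _ _).2 (lexOrder_pos_basis b γ)

theorem v_ofBasis (γ : Γ) : (ofBasis O b hb).v (b γ) = b γ := by
  change (b.repr (b γ)).support.min.map b = _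
  rw [min_support_repr_basis, WithTop.map_coe]

theorem ofBasis_isDense (hd : ∀ x y, O.lt () x y → ∃ γ, O.lt () x (b γ) ∧ O.lt () (b γ) y) :
    (ofBasis O b hb).IsDense := by
  intro x y hxy
  obtain ⟨γ, h1, h2⟩ := hd x y hxy
  refine ⟨b γ, ?_⟩
  rw [v_ofBasis, topLT_coe, topLT_coe]
  exact ⟨h1, h2⟩

/-- Start from the `<₁`-midpoint m of z and w and add a difference of two basis vectors of large
index. This is infinitesimal for the lexicographic order, so the sum stays between z and w, while
density of the basis lets it reach any `<₀`-interval. -/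
theorem ofBasis_isIndependent {e : G} (he : O.lt () 0 e)
    (hd : ∀ x y, O.lt () x y → ∃ γ, O.lt () x (b γ) ∧ O.lt () (b γ) y)
    (hb' : ∀ γ δ, O.lt () (b γ) (b δ) → γ < δ) : (ofBasis O b hb).IsIndependent := by
  let P := lexOrder b.repr
  have hlt : ∀ x, O.lt () x (x + e) := fun x => by
    rw [← O.sub_pos', add_sub_cancel_left]
    exact he
  have hmax : ∀ x y, ∃ γ, O.lt () x (b γ) ∧ O.lt () y (b γ) := by
    intro x y
    rcases eq_or_ne x y with rfl | h
    · obtain ⟨γ, hγ, -⟩ := hd x _ (hlt x)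
      exact ⟨γ, hγ, hγ⟩
    · rcases O.lt_or_lt_of_ne () h with h | h
      · obtain ⟨γ, hγ, -⟩ := hd y _ (hlt y)
        exact ⟨γ, O.lt_trans' h hγ, hγ⟩
      · obtain ⟨γ, hγ, -⟩ := hd x _ (hlt x)
        exact ⟨γ, hγ, O.lt_trans' h hγ⟩
  obtain ⟨γ₀, -⟩ := hmax 0 0
  have key : ∀ x y z w, O.lt () x y → P.lt () z w →
      ∃ s, O.lt () x s ∧ O.lt () s y ∧ P.lt () z s ∧ P.lt () s w := by
    intro x y z w hxy hzw
    have hpos : P.lt () 0 ((1 / 2 : C) • (w - z)) :=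
      P.smul_pos () _ _ (by norm_num) (P.sub_pos'.2 hzw)
    obtain ⟨γ, hγ⟩ : (b.repr ((1 / 2 : C) • (w - z))).support.Nonempty := by
      rw [Finsupp.support_nonempty_iff, Ne, b.repr.map_eq_zero_iff]
      exact (P.ne_of_lt' hpos).symm
    let m := (1 / 2 : C) • (z + w)
    -- The second lower bound on `b δ` forces `b ε` above `b γ` as well, as ε is chosen with `x - m
    -- + b δ <₀ b ε`.
    obtain ⟨δ, hδ1, hδ2⟩ := hmax (b γ) (b γ - (x - m))
    obtain ⟨ε, hε1, hε2⟩ := hd (x - m + b δ) (y - m + b δ) (by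
      rw [O.add_lt_add_iff, ← O.sub_pos', sub_sub_sub_cancel_right, O.sub_pos']
      exact hxy)
    have hγδ : γ < δ := hb' _ _ hδ1
    have hγε : γ < ε := by
      refine hb' _ _ (O.lt_trans' ?_ hε1)
      rw [← O.sub_pos'] at hδ2 ⊢
      convert hδ2 using 1
      abel
    have hsupp : ∀ c : C, ∀ i ∈ (b.repr (c • (b ε - b δ))).support, γ < i := by
      intro c i hi
      rw [map_smul, map_sub, b.repr_self, b.repr_self] at hi
      rcases Finset.mem_union.1 (Finsupp.support_sub (Finsupp.support_smul hi)) with h | h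
      · rwa [Finset.mem_singleton.1 (Finsupp.support_single_subset h)]
      · rwa [Finset.mem_singleton.1 (Finsupp.support_single_subset h)]
    have hadd : ∀ c : C, P.lt () 0 ((1 / 2 : C) • (w - z) + c • (b ε - b δ)) := fun c =>
      lexOrder_pos_add hpos fun i hi => ⟨γ, hγ, hsupp c i hi⟩
    refine ⟨m + (b ε - b δ), ?_, ?_, ?_, ?_⟩
    · rw [← O.sub_pos'] at hε1 ⊢
      convert hε1 using 1
      abel
    · rw [← O.sub_pos'] at hε2 ⊢
      convert hε2 using 1
      abel
    · rw [← P.sub_pos']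
      convert hadd 1 using 1
      simp only [m]
      module
    · rw [← P.sub_pos']
      convert hadd (-1) using 1
      simp only [m]
      module
  -- An infinite right endpoint can be replaced by a finite one, as neither order has a largest
  -- vector. A left endpoint is never `∞`.
  have fin : ∀ r : G → G → Prop, (∀ x, ∃ y, r x y) → ∀ p q : WithTop G, topLT r p q →
      ∃ x y : G, p = x ∧ r x y ∧ ∀ s : G, r s y → topLT r s q := by
    intro r hr p q hpq
    cases p with
    | top => exact absurd hpq (not_top_topLT _ _)
    | coe x =>
      cases q with
      | top =>
        obtain ⟨y, hy⟩ := hr x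
        exact ⟨x, y, rfl, hy, fun s _ => topLT_top _ _⟩
      | coe y => exact ⟨x, y, rfl, (topLT_coe _ _ _).1 hpq, fun s => (topLT_coe _ _ _).2⟩
  rw [HamelSpace.isIndependent_iff]
  intro p q p' q' hpq hpq'
  obtain ⟨x, y, rfl, hxy, hy⟩ := fin (O.lt ()) (fun x => ⟨_, hlt x⟩) p q hpq
  obtain ⟨z, w, rfl, hzw, hw⟩ := fin (P.lt ()) (fun x => ⟨x + b γ₀, by
    rw [← P.sub_pos', add_sub_cancel_left]
    exact lexOrder_pos_basis b γ₀⟩) p' q' hpq'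
  obtain ⟨s, h1, h2, h3, h4⟩ := key x y z w hxy hzw
  exact ⟨s, (topLT_coe _ _ _).2 h1, hy s h2, (topLT_coe _ _ _).2 h3, hw s h4⟩

end DenseBasis

/-! ### Existence of a dense basis and of a model. -/

section Existence

variable (C : Type u) [Field C] [LinearOrder C] [IsStrictOrderedRing C]

/-- Over every ordered field there is an ordered vector space with an order-dense basis. -/
theorem exists_dense_basis : ∃ (G : Type u) (_ : AddCommGroup G) (_ : Module C G)
    (O : MultiOrder Unit C G) (S : Set G) (b : Module.Basis S C G), (∀ x : S, b x = x) ∧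
      (∃ x, O.lt () 0 x) ∧ ∀ x y, O.lt () x y → ∃ z ∈ S, O.lt () x z ∧ O.lt () z y := by
  classical
  -- The index set has as many elements as there are pairs in G, and each pair finds a private index
  -- beyond any given level: the ℕ-coordinate controls the size of a vector, the C-coordinate
  -- separates pairs.
  let J := ℕ ×ₗ C
  let G := J →₀ C
  let O : MultiOrder Unit C G := lexOrder (LinearEquiv.refl C (J →₀ C))
  have hcard : Cardinal.mk (G × G) ≤ Cardinal.mk C := by
    have h1 : Cardinal.mk J = Cardinal.mk C := by
      change Cardinal.mk (ℕ × C) = _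
      rw [Cardinal.mk_prod]
      simp
    have h2 : Cardinal.mk G = Cardinal.mk C := by
      rw [Cardinal.mk_finsupp_of_infinite, h1, max_self]
    simp [h2]
  obtain ⟨ι⟩ : Nonempty (G × G ↪ C) := Cardinal.le_def _ _ |>.1 hcard
  let n : G × G → ℕ := fun p => (p.1.support ∪ p.2.support).sup (fun j => (ofLex j).1) + 1
  let i : G × G → J := fun p => toLex (n p, ι p)
  have hi : Function.Injective i := fun p q h => ι.injective (Prod.ext_iff.1 (toLex.injective h)).2
  have hn : ∀ p q : G × G, n p ≤ n q → p.1 (i q) = 0 ∧ p.2 (i q) = 0 := by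
    intro p q hpq
    have key : i q ∉ p.1.support ∪ p.2.support := by
      intro h
      have : n q ≤ _ := Finset.le_sup (f := fun j : J => (ofLex j).1) h
      exact absurd (this.trans_lt (Nat.lt_succ_self _)) (not_lt.2 hpq)
    rw [Finset.mem_union, not_or, Finsupp.notMem_support_iff, Finsupp.notMem_support_iff] at key
    exact key
  -- The vector for a pair is its midpoint plus an infinitesimal unit at an index private to that
  -- pair. It stays strictly between the two vectors when they are distinct.
  let z : G × G → G := fun p => (1 / 2 : C) • (p.1 + p.2) + Finsupp.single (i p) 1
  have hzv : ∀ (c : C) (p : G × G) (j : J), (c • z p : G) j =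
      c * ((1 / 2) * (p.1 j + p.2 j) + Finsupp.single (i p) (1 : C) j) := fun _ _ _ => rfl
  have hz : LinearIndependent C z := by
    rw [linearIndependent_iff']
    intro s g hg
    by_contra! hne
    obtain ⟨p₀, hp₀, hgp₀⟩ := hne
    -- Take p of maximal level among the pairs with nonzero coefficient. At the private index of p
    -- all midpoints involved vanish, as do the infinitesimal units of the other pairs.
    obtain ⟨p, hp, hmax⟩ := (s.filter fun p => g p ≠ 0).exists_max_image n
      ⟨p₀, Finset.mem_filter.2 ⟨hp₀, hgp₀⟩⟩
    obtain ⟨hps, hgp⟩ := Finset.mem_filter.1 hp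
    have h1 := DFunLike.congr_fun hg (i p)
    rw [Finsupp.finsetSum_apply, Finset.sum_eq_single p] at h1
    · have := hn p p le_rfl
      rw [hzv, this.1, this.2, Finsupp.single_eq_same] at h1
      refine hgp (Eq.trans ?_ h1)
      simp
    · intro q hq hqp
      by_cases hgq : g q = 0
      · rw [hzv, hgq, zero_mul]
      · have := hn q p (hmax q (Finset.mem_filter.2 ⟨hq, hgq⟩))
        rw [hzv, this.1, this.2, Finsupp.single_eq_of_ne (hi.ne hqp).symm]
        simp
    · exact fun h => absurd hps h
  have hzO : ∀ x y, O.lt () x y → O.lt () x (z (x, y)) ∧ O.lt () (z (x, y)) y := by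
    intro x y hxy
    have hpos : O.lt () 0 ((1 / 2 : C) • (y - x)) :=
      O.smul_pos () _ _ (by norm_num) (O.sub_pos'.2 hxy)
    have hlt : ∀ j ∈ ((1 / 2 : C) • (y - x) : G).support, j < i (x, y) := by
      intro j hj
      have h1 : j ∈ x.support ∪ y.support := by
        have := Finsupp.support_sub (Finsupp.support_smul hj)
        rwa [Finset.union_comm]
      have : (ofLex j).1 ≤ _ := Finset.le_sup (f := fun j : J => (ofLex j).1) h1
      exact Prod.Lex.toLex_lt_toLex.2 (Or.inl (Nat.lt_succ_of_le this))
    obtain ⟨k, hk⟩ : ((1 / 2 : C) • (y - x) : G).support.Nonempty := by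
      rw [Finsupp.support_nonempty_iff]
      exact (O.ne_of_lt' hpos).symm
    have hadd : ∀ c : C, O.lt () 0 ((1 / 2 : C) • (y - x) + Finsupp.single (i (x, y)) c) := by
      intro c
      refine lexOrder_pos_add hpos fun j hj => ⟨k, hk, ?_⟩
      have := Finset.mem_singleton.1 (Finsupp.support_single_subset hj)
      rw [this]
      exact hlt k hk
    constructor
    · rw [← O.sub_pos']
      convert hadd 1 using 1
      simp only [z]
      module
    · rw [← O.sub_pos']
      convert hadd (-1) using 1
      simp only [z, Finsupp.single_neg]
      module
  -- An extension of this family to a basis is still order-dense.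
  have hS := hz.linearIndepOn_id
  refine ⟨G, inferInstance, inferInstance, O, _, Module.Basis.extend hS,
    Module.Basis.extend_apply_self hS, ?_, ?_⟩
  · refine ⟨Finsupp.single (toLex (0, 0)) 1, lexOrder_pos_iff.2 ⟨toLex (0, 0), fun j hj => ?_, ?_⟩⟩
    · exact Finsupp.single_eq_of_ne hj.ne
    · exact (zero_lt_one' C).trans_eq (Finsupp.single_eq_same (M := C)).symm
  · intro x y hxy
    exact ⟨z (x, y), hS.subset_extend _ ⟨(x, y), rfl⟩, hzO x y hxy⟩

theorem isSatisfiable_tHam : (THam C).IsSatisfiable := by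
  obtain ⟨G, _, _, O, S, b, hbS, ⟨e, he⟩, hd⟩ := exists_dense_basis C
  have := O.strictTotal ()
  let _ : LinearOrder G := open Classical in linearOrderOfSTO (O.lt ())
  have hb : ∀ γ δ : S, γ < δ ↔ O.lt () (b γ) (b δ) := fun γ δ => by
    rw [hbS, hbS]
    rfl
  have hd' : ∀ x y, O.lt () x y → ∃ γ, O.lt () x (b γ) ∧ O.lt () (b γ) y := fun x y hxy => by
    obtain ⟨z, hz, h⟩ := hd x y hxy
    refine ⟨⟨z, hz⟩, ?_⟩
    rwa [hbS]
  have hM := (ofBasis O b fun γ δ => (hb γ δ).1).models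
    (ofBasis_isIndependent O b _ he hd' fun γ δ => (hb γ δ).2) (ofBasis_isDense O b _ hd')
  have : Nonempty (ofBasis O b fun γ δ => (hb γ δ).1).Carrier := ⟨(⊤ : WithTop G)⟩
  exact Theory.Model.isSatisfiable (ofBasis O b fun γ δ => (hb γ δ).1).Carrier

end Existence

end Hamel

theorem theorem3 {C : Type*} [Field C] [LinearOrder C] [IsStrictOrderedRing C] :
    Hamel.HasQuantifierElimination (Hamel.THam C) ∧ (Hamel.THam C).IsComplete :=
  ⟨fun _ φ => Hamel.exists_isQF_iff_of_tHam φ,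
    Hamel.isComplete_of_isSatisfiable (Hamel.isSatisfiable_tHam C)⟩
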